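/- **Setting.** Let $N$ be a finite undirected graph on a set $A$ of agents, $F$ a finite undirected graph on a non-empty set $K$ of actions, $n,f\ge 0$ integers, $d=n+f$, $q(v)\in(0,1]$ for $v\in A$, $Q=\sum_{v\in A}q(v)$, and $\ell_1,\ell_2,\dots\colon K\to[0,1]$ an arbitrary fixed sequence of losses. For a graph $G$, let $\delta_G$ be the shortest-path distance ($\infty$ between different components), $\mathcal N_m^G(x)=\{y:\delta_G(x,y)\le m\}$, $G^m$ the graph on the same vertices in which distinct $x,y$ are adjacent iff $\delta_G(x,y)\le m$, $\alpha(G)$ the independence number, and $\boxtimes$ the strong product (distinct pairs are adjacent iff in each coordinate they are equal or adjacent). **Protocol.** In each round $t=1,2,\dots$ every agent $v$ is active with probability $q(v)$, independently of the past and of the other agents; every active agent $v$ independently draws an action $I_t(v)$ from its current distribution $p_t(\cdot,v)$ on $K$ and incurs the loss $\ell_t(I_t(v))$. Let $\mathcal A_t$ be the set of active agents. Put $$b_t(i,v)=1-\prod_{u\in\mathcal N_n^N(v)}\Bigl(1-q(u)\sum_{j\in\mathcal N_f^F(i)}p_t(j,u)\Bigr),\qquad \widehat\ell_t(i,v)=\frac{\ell_t(i)}{b_t(i,v)}\,\mathbb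 I\bigl\{\exists u\in\mathcal N_n^N(v)\cap\mathcal A_t:\ I_t(u)\in\mathcal N_f^F(i)\bigr\}.$$ **Algorithm (Exp3-$\alpha^2$ with a local doubling trick).** The rounds are split, separately for each agent $v$, into consecutive phases $r=r_0,r_0+1,\dots$ with $r_0=\lceil\log_2\ln|K|\rceil$ (if $|K|=1$, put $r_0=0$). In round $t$ of a phase $r$ of agent $v$ whose first round is $t_r=t_r(v)$, the agent uses $$p_t(i,v)\propto\exp\Bigl(-\eta_r\sum_{s=t_r}^{t-d-1}\widehat\ell_s(i,v)\Bigr),\qquad \eta_r=\sqrt{(\ln|K|)/2^r}.$$ Let $X_{r,s}(v)=\mathbb I\{s>t_r+d\}\bigl(d+\sum_{i\in K}p_s(i,v)/b_s(i,v)\bigr)$. Phase $r$ lasts as long as the sum of these quantities over its rounds does not exceed $2^r$, which all agents decide simultaneously at the beginning of each round $t$: agent $v$ stays in phase $r$ iff $\sum_{s=t_r}^{t-1}X_{r,s}(v)+X'_{r,t}(v)\le 2^r$, where $X'_{r,t}(v)$ is the value that $X_{r,t}(v)$ has if no agent changes its phase in round $t$; otherwise it starts phase $r+1$ from scratch in round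 $t$. **Theorem.** There are universal constants $C>0$ and $k\in\mathbb N$ such that, for every instance as above and every $T\ge 1$, the network regret $$R_T=\max_{i\in K}\mathbb E\Bigl[\sum_{t=1}^T\sum_{v\in\mathcal A_t}\ell_t\bigl(I_t(v)\bigr)-\sum_{t=1}^T|\mathcal A_t|\,\ell_t(i)\Bigr]$$ satisfies $$R_T\le C\bigl(1+\ln(|K|\,T)\bigr)^k\sqrt{Q\bigl(\alpha(N^n\boxtimes F^f)+dQ\bigr)T},$$ that is, $R_T=\widetilde{\mathcal O}\bigl(\sqrt{Q(\alpha(N^n\boxtimes F^f)+dQ)T}\bigr)$. The algorithm does not use $T$, $Q$ or $\alpha(N^n\boxtimes F^f)$. -/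

import Mathlib

namespace CoopLearning

/-- The `m`-th power of `G`: distinct vertices are adjacent iff their shortest-path distance is at
most `m` (the distance is `∞` between different components; the self-loops stay implicit). -/
def graphPower {V : Type*} (G : SimpleGraph V) (m : ℕ) : SimpleGraph V where
  Adj u v := u ≠ v ∧ G.edist u v ≤ m
  symm := ⟨fun _ _ h => ⟨h.1.symm, by rw [SimpleGraph.edist_comm]; exact h.2⟩⟩
  loopless := ⟨fun _ h => h.1 rfl⟩

/-- The strong product: distinct pairs are adjacent iff they are equal or adjacent in each of the
two coordinates. -/
def strongProduct {V W : Type*} (G : SimpleGraph V) (H : SimpleGraph W) :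
    SimpleGraph (V × W) where
  Adj x y := x ≠ y ∧ (x.1 = y.1 ∨ G.Adj x.1 y.1) ∧ (x.2 = y.2 ∨ H.Adj x.2 y.2)
  symm := ⟨fun _ _ h =>
    ⟨h.1.symm, h.2.1.imp Eq.symm SimpleGraph.Adj.symm, h.2.2.imp Eq.symm SimpleGraph.Adj.symm⟩⟩
  loopless := ⟨fun _ h => h.1 rfl⟩

open Classical in
/-- The `m`-neighbourhood of a vertex: all vertices at shortest-path distance at most `m`. -/
noncomputable def nbhd {V : Type*} [Fintype V] (G : SimpleGraph V) (m : ℕ) (v : V) : Finset V :=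
  Finset.univ.filter fun u => G.edist v u ≤ m

/-- An instance of the problem with agents `A` and actions `K`: communication network `N` with
maximum delay `n`, feedback graph `F` with maximum delay `f`, activation probabilities `q`, and a
sequence of losses fixed in advance (an oblivious adversary); rounds are `t = 1, 2, …`. -/
structure Problem (A K : Type*) where
  N : SimpleGraph A
  n : ℕ
  F : SimpleGraph K
  f : ℕ
  q : A → ℝ
  q_pos : ∀ v, 0 < q v
  q_le_one : ∀ v, q v ≤ 1
  loss : ℕ → K → ℝ
  loss_nonneg : ∀ t i, 0 ≤ loss t i
  loss_le_one : ∀ t i, loss t i ≤ 1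

/-- The outcome of one round: `none` for an inactive agent, `some i` for an active agent that
plays the action `i`. -/
abbrev Profile (A K : Type*) := A → Option K

/-- What the local instances remember: for every agent its current phase `r`, the first round of
that phase and the sum of the quantities `X_{r,s}` over the rounds `s` of that phase so far, and
the importance-weighted loss estimates `est s i v` of the completed rounds `s`. -/
structure State (A K : Type*) where
  phase : A → ℕ
  start : A → ℕ
  mass : A → ℝ
  est : ℕ → K → A → ℝ

/-- The index `⌈log₂ ln |K|⌉` of the first phase; it is nonnegative as soon as `|K| ≥ 2`. -/
noncomputable def firstPhase (K : Type*) [Fintype K] : ℕ :=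
  ⌈Real.logb 2 (Real.log (Fintype.card K))⌉₊

/-- The learning rate in phase `r`. -/
noncomputable def rate (K : Type*) [Fintype K] (r : ℕ) : ℝ :=
  Real.sqrt (Real.log (Fintype.card K) / 2 ^ r)

/-- Everybody starts the first phase in round `1`. -/
noncomputable def initialState (A K : Type*) [Fintype K] : State A K where
  phase := fun _ => firstPhase K
  start := fun _ => 1
  mass := fun _ => 0
  est := fun _ _ _ => 0

namespace Problem

variable {A K : Type*} [Fintype A] [Fintype K]

set_option linter.unusedSectionVars false

/-- The total delay. -/
def d (P : Problem A K) : ℕ := P.n + P.f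

/-- The expected number of active agents. -/
noncomputable def Q (P : Problem A K) : ℝ := ∑ v, P.q v

/-- The independence number of the strong product of the powers of the two graphs. -/
noncomputable def alpha (P : Problem A K) : ℕ :=
  (strongProduct (graphPower P.N P.n) (graphPower P.F P.f)).indepNum

/-- The exponential weight `w_t(i,v)`: only the estimates of the rounds `s` with
`start ≤ s ≤ t - d - 1` enter (none if `t ≤ start + d`). -/
noncomputable def weight (P : Problem A K) (S : State A K) (t : ℕ) (i : K) (v : A) : ℝ :=
  Real.exp (-(rate K (S.phase v) * ∑ s ∈ Finset.Ico (S.start v) (t - P.d), S.est s i v))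

/-- The probability `p_t(i,v)` of action `i` in the distribution of agent `v`. -/
noncomputable def prob (P : Problem A K) (S : State A K) (t : ℕ) (i : K) (v : A) : ℝ :=
  P.weight S t i v / ∑ j, P.weight S t j v

/-- The probability `b_t(i,v)` that an agent in the `n`-neighbourhood of `v` plays an action in
the `f`-neighbourhood of `i`, when active agents `u` draw their actions from `p(·,u)`. -/
noncomputable def obsProb (P : Problem A K) (p : K → A → ℝ) (i : K) (v : A) : ℝ :=
  1 - ∏ u ∈ nbhd P.N P.n v, (1 - P.q u * ∑ j ∈ nbhd P.F P.f i, p j u)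

/-- The event `B_t(i,v)`. -/
def Observed (P : Problem A K) (x : Profile A K) (i : K) (v : A) : Prop :=
  ∃ u ∈ nbhd P.N P.n v, ∃ j ∈ nbhd P.F P.f i, x u = some j

/-- The quantity `X_{r,t}(v)`, computed from the phases and distributions of all agents in the
state `S`. -/
noncomputable def increment (P : Problem A K) (S : State A K) (t : ℕ) (v : A) : ℝ :=
  if S.start v + P.d < t then
    (P.d : ℝ) + ∑ i, P.prob S t i v / P.obsProb (P.prob S t) i v
  else 0

open Classical in
/-- The beginning of round `t`: an agent stays in its phase `r` if the sum of the quantities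
`X_{r,s}` stays at most `2 ^ r` when the round `t` is included; otherwise the previous round was the
last one of phase `r`, and the agent starts phase `r + 1` from scratch in round `t`. All agents
decide simultaneously, so the value of `X_{r,t}` in this test is the one for the case that nobody
changes phase (`S` is the state at the end of round `t - 1`). -/
noncomputable def beginRound (P : Problem A K) (S : State A K) (t : ℕ) : State A K where
  phase := fun v =>
    if S.mass v + P.increment S t v ≤ 2 ^ S.phase v then S.phase v else S.phase v + 1
  start := fun v =>
    if S.mass v + P.increment S t v ≤ 2 ^ S.phase v then S.start v else t
  mass := fun v =>
    if S.mass v + P.increment S t v ≤ 2 ^ S.phase v then S.mass v else 0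
  est := S.est

open Classical in
/-- The end of round `t`, played in state `S` (the one after `beginRound`) with outcome `x`: the
quantities `X_{r,t}` of the distributions that were really used are added up, and the estimates
`ℓ_t(i) B_t(i,v) / b_t(i,v)` are recorded. -/
noncomputable def endRound (P : Problem A K) (S : State A K) (t : ℕ) (x : Profile A K) :
    State A K where
  phase := S.phase
  start := S.start
  mass := fun v => S.mass v + P.increment S t v
  est := Function.update S.est t fun i v =>
    if P.Observed x i v then P.loss t i / P.obsProb (P.prob S t) i v else 0

/-- The state at the end of round `T`, when the outcome of round `t + 1` is `ω t`. -/
noncomputable def stateAfter (P : Problem A K) :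
    (T : ℕ) → (Fin T → Profile A K) → State A K
  | 0, _ => initialState A K
  | T + 1, ω =>
      P.endRound (P.beginRound (P.stateAfter T (Fin.init ω)) (T + 1)) (T + 1) (ω (Fin.last T))

/-- The probability of what a single agent does in a round: it is inactive with probability
`1 - q(v)`, and active and playing `i` with probability `q(v) p_t(i,v)`. -/
noncomputable def agentProb (P : Problem A K) (S : State A K) (t : ℕ) (v : A) :
    Option K → ℝ
  | none => 1 - P.q v
  | some i => P.q v * P.prob S t i v

theorem prob_nonneg (P : Problem A K) (S : State A K) (t : ℕ) (i : K) (v : A) :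
    0 ≤ P.prob S t i v :=
  div_nonneg (Real.exp_nonneg _) (Finset.sum_nonneg fun _ _ => Real.exp_nonneg _)

theorem sum_prob [Nonempty K] (P : Problem A K) (S : State A K) (t : ℕ) (v : A) :
    ∑ i, P.prob S t i v = 1 := by
  unfold prob
  rw [← Finset.sum_div]
  exact div_self
    (Finset.sum_pos (fun _ _ => Real.exp_pos _) Finset.univ_nonempty).ne'

theorem agentProb_nonneg (P : Problem A K) (S : State A K) (t : ℕ) (v : A) (o : Option K) :
    0 ≤ P.agentProb S t v o := by
  cases o with
  | none => exact sub_nonneg.2 (P.q_le_one v)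
  | some i => exact mul_nonneg (P.q_pos v).le (P.prob_nonneg S t i v)

theorem sum_agentProb [Nonempty K] (P : Problem A K) (S : State A K) (t : ℕ) (v : A) :
    ∑ o, P.agentProb S t v o = 1 := by
  rw [Fintype.sum_option]
  simp only [agentProb]
  rw [← Finset.mul_sum, sum_prob]
  ring

open Classical in
theorem sum_roundProb [Nonempty K] (P : Problem A K) (S : State A K) (t : ℕ) :
    ∑ x : Profile A K, ENNReal.ofReal (∏ v, P.agentProb S t v (x v)) = 1 := by
  rw [← ENNReal.ofReal_sum_of_nonneg fun x _ =>
    Finset.prod_nonneg fun v _ => P.agentProb_nonneg S t v (x v)]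
  have h := Finset.prod_univ_sum (fun _ : A => (Finset.univ : Finset (Option K)))
    (fun v o => P.agentProb S t v o)
  rw [Fintype.piFinset_univ] at h
  rw [← h]
  simp only [sum_agentProb, Finset.prod_const_one, ENNReal.ofReal_one]

open Classical in
/-- The law of the outcome of round `t` in state `S`: the agents act independently. -/
noncomputable def roundLaw [Nonempty K] (P : Problem A K) (S : State A K) (t : ℕ) :
    PMF (Profile A K) :=
  PMF.ofFintype (fun x => ENNReal.ofReal (∏ v, P.agentProb S t v (x v))) (P.sum_roundProb S t)

/-- The joint law of the outcomes of the rounds `1, …, T`. -/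
noncomputable def law [Nonempty K] (P : Problem A K) :
    (T : ℕ) → PMF (Fin T → Profile A K)
  | 0 => PMF.pure Fin.elim0
  | T + 1 => (P.law T).bind fun ω =>
      (P.roundLaw (P.beginRound (P.stateAfter T ω) (T + 1)) (T + 1)).map fun x =>
        Fin.snoc (α := fun _ => Profile A K) ω x

/-- The excess loss of the active agents over the constant action `i` in the rounds `1, …, T`. -/
def excess (P : Problem A K) (T : ℕ) (ω : Fin T → Profile A K) (i : K) : ℝ :=
  (∑ t : Fin T, ∑ v, (ω t v).elim 0 (P.loss ((t : ℕ) + 1)))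
    - ∑ t : Fin T, ((Finset.univ.filter fun v => (ω t v).isSome).card : ℝ) * P.loss ((t : ℕ) + 1) i

open Classical in
/-- The network regret `R_T`. -/
noncomputable def regret [Nonempty K] (P : Problem A K) (T : ℕ) : ℝ :=
  Finset.univ.sup' Finset.univ_nonempty fun i : K =>
    ∑ ω : Fin T → Profile A K, (P.law T ω).toReal * P.excess T ω i

end Problem

end CoopLearning

/-! Activity in a round is independent of the past, so the network regret is the `q`-weighted sum of
the agents' regrets (`excess_expect`), and unbiasedness lets every loss be replaced by its estimate
(`expect_regret_eq`). Exponential weights that miss the last `d` losses pay at most `ln |K| / η` per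
phase plus a drift `η ∑ p (m + e) e` per round, with `m` the missing and `e` the current estimates
(`exp_weights_step`). Everything that governs a round, phases included, is determined by outcomes
more than `d` rounds old. Missing and current estimates can therefore be averaged one after the
other, and the drift costs at most `η (d + ∑ p / b)` in expectation (`expect_drift_le`), the very
quantity that the doubling trick adds up.

Phase `r` thus costs `ln |K| / η_r + η_r 2 ^ r`, two equal terms, plus at most 1 for each of at most
`d + 2` exceptional rounds: the first `d + 1`, and one in which the budget is overrun because agents
change phase at the same moment. The square roots form a geometric sum, dominated by the last phase
`R(v)`. The surplus `d + 2` exceeds `√(2 ^ r)` only if `2 ^ r < (d + 2) ^ 2`, hence in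
logarithmically many phases.

It remains to bound `2 ^ R(v)`, which is at most `2 ^ r₀` plus twice the sum of all `X` and `X'`
(`two_pow_phase_le`). In every state the `q`-weighted sum of these over the agents is at most `2 (α
+ d Q)` (`sum_increment_le`): `1 / b` is at most one plus the inverse weight of a neighbourhood in
the strong product, and a weighted Caro–Wei inequality brings in `α`. Cauchy–Schwarz for `∑ q √(2 ^
R)` then gives the rate, on every path. For `T ≤ d` the trivial bound `Q T` is good enough. -/

namespace CoopLearning

/-! ### Weighted Caro–Wei inequality and observation probabilities -/

section Graph

open Classical

/-- The weighted Caro–Wei bound, relative to a finite set of vertices. -/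
theorem exists_isIndepSet_sum_div_le {V : Type*} [Fintype V] (G : SimpleGraph V) (w : V → ℝ)
    (hw : ∀ x, 0 < w x) (s : Finset V) :
    ∃ I : Finset V, I ⊆ s ∧ G.IsIndepSet (I : Set V) ∧
      ∑ x ∈ s, w x / ∑ y ∈ s with x = y ∨ G.Adj x y, w y ≤ I.card := by
  induction s using Finset.strongInduction with
  | H s ih =>
    rcases s.eq_empty_or_nonempty with rfl | hs
    · exact ⟨∅, by simp, by simp [SimpleGraph.IsIndepSet], by simp⟩
    obtain ⟨x, hx, hmin⟩ := s.exists_min_image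
      (fun x => ∑ y ∈ s with x = y ∨ G.Adj x y, w y) hs
    set W : V → ℝ := fun x => ∑ y ∈ s with x = y ∨ G.Adj x y, w y with hW
    have hWpos : ∀ y ∈ s, 0 < W y := fun y hy =>
      Finset.sum_pos (fun z _ => hw z) ⟨y, by simp [hy]⟩
    set s' := s.filter fun y => ¬ (x = y ∨ G.Adj x y) with hs'
    have hss : s' ⊂ s := Finset.filter_ssubset.2 ⟨x, hx, by simp⟩
    obtain ⟨I, hIs, hI, hle⟩ := ih s' hss
    have hxI : x ∉ I := fun h => by
      have := hIs h
      simp [hs'] at this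
    refine ⟨insert x I, ?_, ?_, ?_⟩
    · exact Finset.insert_subset hx (hIs.trans hss.subset)
    · rw [Finset.coe_insert]
      intro a ha b hb hab
      have key : ∀ c ∈ I, ¬ G.Adj x c := fun c hc h => by
        have := hIs hc
        simp [hs', h] at this
      rcases ha with rfl | ha <;> rcases hb with rfl | hb
      · exact absurd rfl hab
      · exact key b hb
      · exact fun h => key a ha h.symm
      · exact hI ha hb hab
    · rw [Finset.card_insert_of_notMem hxI, ← Finset.sum_filter_add_sum_filter_not s
        (fun y => x = y ∨ G.Adj x y)]
      -- Greedy choice: `x` has the lightest closed neighbourhood, so the terms removed together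
      -- with it add up to at most 1. Deleting vertices only shrinks the remaining denominators,
      -- which is the right direction for the induction.
      have h1 : ∑ y ∈ s with x = y ∨ G.Adj x y, w y / W y ≤ 1 := by
        calc ∑ y ∈ s with x = y ∨ G.Adj x y, w y / W y
            ≤ ∑ y ∈ s with x = y ∨ G.Adj x y, w y / W x := by
              refine Finset.sum_le_sum fun y hy => ?_
              exact div_le_div_of_nonneg_left (hw y).le (hWpos x hx)
                (hmin y (Finset.mem_of_mem_filter y hy))
          _ = 1 := by
              rw [← Finset.sum_div]
              exact div_self (hWpos x hx).ne'
      have h2 : ∑ y ∈ s', w y / W y ≤ I.card := by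
        refine le_trans (Finset.sum_le_sum fun y hy => ?_) hle
        refine div_le_div_of_nonneg_left (hw y).le ?_ ?_
        · exact Finset.sum_pos (fun z _ => hw z) ⟨y, by simp [hy]⟩
        · exact Finset.sum_le_sum_of_subset_of_nonneg
            (Finset.filter_subset_filter _ hss.subset) fun z _ _ => (hw z).le
      push_cast
      linarith

theorem sum_div_le_indepNum {V : Type*} [Fintype V] (G : SimpleGraph V) (w : V → ℝ)
    (hw : ∀ x, 0 < w x) :
    ∑ x, w x / ∑ y with x = y ∨ G.Adj x y, w y ≤ G.indepNum := by
  obtain ⟨I, -, hI, hle⟩ := exists_isIndepSet_sum_div_le G w hw Finset.univ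
  exact hle.trans (by exact_mod_cast hI.card_le_indepNum)

theorem eq_or_graphPower_adj {V : Type*} (G : SimpleGraph V) (m : ℕ) (u v : V) :
    (u = v ∨ (graphPower G m).Adj u v) ↔ G.edist u v ≤ m := by
  by_cases h : u = v
  · subst h; simp
  · simp [h, graphPower]

theorem eq_or_strongProduct_adj {V W : Type*} (G : SimpleGraph V) (H : SimpleGraph W)
    (x y : V × W) :
    (x = y ∨ (strongProduct G H).Adj x y) ↔
      (x.1 = y.1 ∨ G.Adj x.1 y.1) ∧ (x.2 = y.2 ∨ H.Adj x.2 y.2) := by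
  by_cases h : x = y
  · subst h; simp
  · simp [h, strongProduct]

/-- With `S = ∑ a`, the product is at most `exp (-S) ≤ 1 / (1 + S)`, and the inverse of `S / (1 +
S)` is `1 + 1 / S`. -/
theorem one_div_one_sub_prod_le {ι : Type*} (s : Finset ι) (a : ι → ℝ)
    (h1 : ∀ u ∈ s, a u ≤ 1) (hpos : 0 < ∑ u ∈ s, a u) :
    0 < 1 - ∏ u ∈ s, (1 - a u) ∧
      1 / (1 - ∏ u ∈ s, (1 - a u)) ≤ 1 + 1 / ∑ u ∈ s, a u := by
  set S := ∑ u ∈ s, a u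
  have hprod : ∏ u ∈ s, (1 - a u) ≤ Real.exp (-S) := by
    rw [← Finset.sum_neg_distrib, Real.exp_sum]
    refine Finset.prod_le_prod (fun u hu => sub_nonneg.2 (h1 u hu)) fun u _ => ?_
    linarith [Real.add_one_le_exp (-a u)]
  have hexp : Real.exp (-S) ≤ 1 / (1 + S) := by
    rw [Real.exp_neg, ← one_div]
    exact one_div_le_one_div_of_le (by linarith) (by linarith [Real.add_one_le_exp S])
  have hb : S / (1 + S) ≤ 1 - ∏ u ∈ s, (1 - a u) := by
    have : S / (1 + S) = 1 - 1 / (1 + S) := by field_simp; ring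
    linarith
  have hS : 0 < S / (1 + S) := by positivity
  refine ⟨hS.trans_le hb, (one_div_le_one_div_of_le hS hb).trans_eq ?_⟩
  field_simp
  ring

end Graph

/-! ### The increments of one round, summed over the agents -/

namespace Problem

set_option linter.unusedSectionVars false

variable {A K : Type*} [Fintype A] [Fintype K] (P : Problem A K)

theorem Q_nonneg : 0 ≤ P.Q := Finset.sum_nonneg fun v _ => (P.q_pos v).le

theorem mem_nbhd_self {V : Type*} [Fintype V] (G : SimpleGraph V) (m : ℕ) (v : V) :
    v ∈ nbhd G m v := by simp [nbhd]

/-- The total weight `∑ q(u) p(j,u)` over the neighbourhood of `(v,i)` in the strong product. -/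
noncomputable def nbhdWeight (p : K → A → ℝ) (i : K) (v : A) : ℝ :=
  ∑ u ∈ nbhd P.N P.n v, P.q u * ∑ j ∈ nbhd P.F P.f i, p j u

theorem nbhdWeight_pos {p : K → A → ℝ} (hp : ∀ i v, 0 < p i v) (i : K) (v : A) :
    0 < P.nbhdWeight p i v :=
  Finset.sum_pos (fun u _ => mul_pos (P.q_pos u) (Finset.sum_pos (fun j _ => hp j u)
    ⟨i, mem_nbhd_self _ _ _⟩)) ⟨v, mem_nbhd_self _ _ _⟩

theorem obsProb_bounds {p : K → A → ℝ} (hp : ∀ i v, 0 < p i v) (hs : ∀ v, ∑ i, p i v = 1)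
    (i : K) (v : A) :
    0 < P.obsProb p i v ∧ 1 / P.obsProb p i v ≤ 1 + 1 / P.nbhdWeight p i v := by
  refine one_div_one_sub_prod_le _ _ (fun u _ => ?_) (P.nbhdWeight_pos hp i v)
  have h : ∑ j ∈ nbhd P.F P.f i, p j u ≤ 1 := by
    rw [← hs u]
    exact Finset.sum_le_sum_of_subset_of_nonneg (Finset.subset_univ _) fun j _ _ => (hp j u).le
  have h0 : 0 ≤ ∑ j ∈ nbhd P.F P.f i, p j u := Finset.sum_nonneg fun j _ => (hp j u).le
  exact mul_le_one₀ (P.q_le_one u) h0 h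

/-- Closed neighbourhoods in the strong product of the powers are products of the two
neighbourhoods, so this is Caro–Wei with weights `q(v) p(i,v)`. The distributions of different
agents may be unrelated. -/
theorem sum_div_nbhdWeight_le {p : K → A → ℝ} (hp : ∀ i v, 0 < p i v) :
    ∑ v, ∑ i, P.q v * p i v / P.nbhdWeight p i v ≤ P.alpha := by
  classical
  have h := sum_div_le_indepNum (strongProduct (graphPower P.N P.n) (graphPower P.F P.f))
    (fun x => P.q x.1 * p x.2 x.1) fun x => mul_pos (P.q_pos _) (hp _ _)
  rw [Fintype.sum_prod_type] at h
  refine le_trans (le_of_eq ?_) h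
  refine Finset.sum_congr rfl fun v _ => Finset.sum_congr rfl fun i _ => ?_
  congr 1
  symm
  trans ∑ y ∈ nbhd P.N P.n v ×ˢ nbhd P.F P.f i, P.q y.1 * p y.2 y.1
  · refine Finset.sum_congr ?_ fun _ _ => rfl
    ext y
    simp only [Finset.mem_filter, Finset.mem_univ, true_and, Finset.mem_product, nbhd,
      eq_or_strongProduct_adj, eq_or_graphPower_adj]
  · rw [nbhdWeight, Finset.sum_product]
    simp only [Finset.mul_sum]

theorem sum_div_obsProb_le {p : K → A → ℝ} (hp : ∀ i v, 0 < p i v)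
    (hs : ∀ v, ∑ i, p i v = 1) :
    ∑ v, P.q v * ∑ i, p i v / P.obsProb p i v ≤ P.Q + P.alpha := by
  have h1 : ∀ v, P.q v * ∑ i, p i v / P.obsProb p i v ≤
      P.q v + ∑ i, P.q v * p i v / P.nbhdWeight p i v := by
    intro v
    calc P.q v * ∑ i, p i v / P.obsProb p i v
        ≤ P.q v * ∑ i, (p i v + p i v / P.nbhdWeight p i v) := by
          refine mul_le_mul_of_nonneg_left (Finset.sum_le_sum fun i _ => ?_) (P.q_pos v).le
          have := mul_le_mul_of_nonneg_left (P.obsProb_bounds hp hs i v).2 (hp i v).le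
          rwa [mul_add, mul_one_div, mul_one_div, mul_one] at this
      _ = _ := by
          rw [Finset.sum_add_distrib, hs, mul_add, mul_one, Finset.mul_sum]
          simp only [mul_div_assoc]
  refine (Finset.sum_le_sum fun v _ => h1 v).trans ?_
  rw [Finset.sum_add_distrib]
  exact add_le_add le_rfl (P.sum_div_nbhdWeight_le hp)

theorem card_mul_card_le_alpha (hd : P.d = 0) :
    Fintype.card A * Fintype.card K ≤ P.alpha := by
  have hn : P.n = 0 := by unfold d at hd; omega
  have hf : P.f = 0 := by unfold d at hd; omega
  have : (strongProduct (graphPower P.N P.n) (graphPower P.F P.f)).IsIndepSet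
      ((Finset.univ : Finset (A × K)) : Set (A × K)) := by
    intro x _ y _ hxy h
    have := (eq_or_strongProduct_adj _ _ x y).1 (Or.inr h)
    rw [eq_or_graphPower_adj, eq_or_graphPower_adj, hn, hf] at this
    simp at this
    exact hxy (Prod.ext this.1 this.2)
  have h := this.card_le_indepNum
  rwa [Finset.card_univ, Fintype.card_prod] at h

/-- Absorbs the stray `Q` of `sum_div_obsProb_le`. For `d = 0` both powers are edgeless and `α ≥ |A|
≥ Q`; otherwise `d Q ≥ Q`. -/
theorem Q_le_alpha_add [Nonempty K] : P.Q ≤ P.alpha + P.d * P.Q := by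
  rcases Nat.eq_zero_or_pos P.d with hd | hd
  · have h1 : P.Q ≤ Fintype.card A := by
      refine (Finset.sum_le_sum fun v _ => P.q_le_one v).trans ?_
      simp
    have h2 : Fintype.card A ≤ P.alpha :=
      le_trans (Nat.le_mul_of_pos_right _ Fintype.card_pos) (P.card_mul_card_le_alpha hd)
    have h3 : (Fintype.card A : ℝ) ≤ P.alpha := by exact_mod_cast h2
    rw [hd]; simp; linarith
  · have : (1 : ℝ) ≤ P.d := by exact_mod_cast hd
    nlinarith [P.Q_nonneg, (Nat.cast_nonneg P.alpha : (0:ℝ) ≤ P.alpha)]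

theorem prob_pos [Nonempty K] (S : State A K) (t : ℕ) (i : K) (v : A) : 0 < P.prob S t i v :=
  div_pos (Real.exp_pos _) (Finset.sum_pos (fun _ _ => Real.exp_pos _) Finset.univ_nonempty)

theorem obsProb_pos [Nonempty K] (S : State A K) (t : ℕ) (i : K) (v : A) :
    0 < P.obsProb (P.prob S t) i v :=
  (P.obsProb_bounds (P.prob_pos S t) (P.sum_prob S t) i v).1

theorem increment_nonneg [Nonempty K] (S : State A K) (t : ℕ) (v : A) :
    0 ≤ P.increment S t v := by
  unfold increment
  split_ifs
  · exact add_nonneg (Nat.cast_nonneg _) (Finset.sum_nonneg fun i _ =>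
      (div_pos (P.prob_pos S t i v) (P.obsProb_pos S t i v)).le)
  · exact le_rfl

/-- Since the state is arbitrary, this serves both for the `X` actually incurred and for the
hypothetical `X'` of the phase test. -/
theorem sum_increment_le [Nonempty K] (S : State A K) (t : ℕ) :
    ∑ v, P.q v * P.increment S t v ≤ 2 * (P.alpha + P.d * P.Q) := by
  have h1 : ∑ v, P.q v * P.increment S t v ≤ ∑ v, (P.q v * P.d +
      P.q v * ∑ i, P.prob S t i v / P.obsProb (P.prob S t) i v) := by
    refine Finset.sum_le_sum fun v _ => ?_
    rw [← mul_add]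
    refine mul_le_mul_of_nonneg_left ?_ (P.q_pos v).le
    unfold increment
    split_ifs
    · exact le_rfl
    · exact add_nonneg (Nat.cast_nonneg _) (Finset.sum_nonneg fun i _ =>
        (div_pos (P.prob_pos S t i v) (P.obsProb_pos S t i v)).le)
  rw [Finset.sum_add_distrib, ← Finset.sum_mul] at h1
  have h2 := P.sum_div_obsProb_le (P.prob_pos S t) (P.sum_prob S t)
  have h3 := P.Q_le_alpha_add
  have h4 : ∑ v, P.q v = P.Q := rfl
  rw [h4] at h1
  linarith

end Problem
end CoopLearning

/-! ### Expectations over infinite paths -/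

namespace CoopLearning.Problem

open Classical

set_option linter.unusedSectionVars false

variable {A K : Type*} [Fintype A] [Fintype K] [Nonempty K] (P : Problem A K)

/-- The state at the end of round `t` along the path `ω`, where `ω t` is the outcome of
round `t + 1`. -/
noncomputable def after (ω : ℕ → Profile A K) (t : ℕ) : State A K :=
  P.stateAfter t fun i => ω i

/-- The state in which round `t + 1` is played along the path `ω`. -/
noncomputable def played (ω : ℕ → Profile A K) (t : ℕ) : State A K :=
  P.beginRound (P.after ω t) (t + 1)

/-- The loss estimates of round `s` along the path `ω`. -/
noncomputable def lossEst (ω : ℕ → Profile A K) (s : ℕ) (i : K) (v : A) : ℝ :=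
  (P.after ω s).est s i v

/-- The distributions used in round `t + 1` along the path `ω`. -/
noncomputable def dist (ω : ℕ → Profile A K) (t : ℕ) : K → A → ℝ :=
  P.prob (P.played ω t) (t + 1)

/-- The probability of the outcome `x` in round `t + 1` along the path `ω`. -/
noncomputable def stepProb (ω : ℕ → Profile A K) (t : ℕ) (x : Profile A K) : ℝ :=
  ∏ v, P.agentProb (P.played ω t) (t + 1) v (x v)

/-- The expectation of `g` when the rounds `1, …, T` are random and nobody is active later. -/
noncomputable def expect : ℕ → ((ℕ → Profile A K) → ℝ) → ℝ
  | 0, g => g fun _ _ => none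
  | T + 1, g => expect T fun ω => ∑ x, P.stepProb ω T x * g (Function.update ω T x)

theorem after_zero (ω : ℕ → Profile A K) : P.after ω 0 = initialState A K := rfl

theorem after_succ (ω : ℕ → Profile A K) (t : ℕ) :
    P.after ω (t + 1) = P.endRound (P.played ω t) (t + 1) (ω t) := rfl

theorem stepProb_nonneg (ω : ℕ → Profile A K) (t : ℕ) (x : Profile A K) :
    0 ≤ P.stepProb ω t x :=
  Finset.prod_nonneg fun v _ => P.agentProb_nonneg _ _ v (x v)

theorem sum_prod_profile (h : A → Option K → ℝ) :
    ∑ x : Profile A K, ∏ v, h v (x v) = ∏ v, ∑ o, h v o := by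
  have := Finset.prod_univ_sum (fun _ : A => (Finset.univ : Finset (Option K))) h
  rw [Fintype.piFinset_univ] at this
  exact this.symm

theorem sum_stepProb (ω : ℕ → Profile A K) (t : ℕ) : ∑ x, P.stepProb ω t x = 1 := by
  unfold stepProb
  rw [sum_prod_profile]
  simp [P.sum_agentProb]

theorem law_succ_snoc (T : ℕ) (ω : Fin T → Profile A K) (x : Profile A K) :
    P.law (T + 1) (Fin.snoc (α := fun _ => Profile A K) ω x) =
      P.law T ω * P.roundLaw (P.beginRound (P.stateAfter T ω) (T + 1)) (T + 1) x := by
  simp only [law, PMF.bind_apply, PMF.map_apply]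
  rw [tsum_eq_single ω]
  · congr 1
    rw [tsum_eq_single x]
    · simp
    · intro y hy
      rw [if_neg]
      intro h
      exact hy (Fin.snoc_injective2 h).2.symm
  · intro ω' hω
    convert mul_zero _
    rw [ENNReal.tsum_eq_zero]
    intro y
    rw [if_neg]
    intro h
    exact hω (Fin.snoc_injective2 h).1.symm

/-- Passes from the law on `Fin T` to iterated finite sums over infinite paths. There all horizons
share one path space, and conditioning on the past is peeling off the last sum. -/
theorem expect_law (T : ℕ) (g : (Fin T → Profile A K) → ℝ) :
    ∑ ω, (P.law T ω).toReal * g ω = P.expect T fun ω => g fun i => ω i := by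
  induction T with
  | zero =>
    have h : ∀ ω : Fin 0 → Profile A K, P.law 0 ω = 1 := fun ω => by
      rw [law, Subsingleton.elim ω Fin.elim0]
      exact PMF.pure_apply_self _
    simp only [h]
    rw [Fintype.sum_unique]
    simp only [expect, ENNReal.toReal_one, one_mul]
    exact congrArg g (Subsingleton.elim _ _)
  | succ T ih =>
    rw [← (Fin.snocEquiv fun _ : Fin (T + 1) => Profile A K).sum_comp, Fintype.sum_prod_type,
      Finset.sum_comm]
    have h := ih fun ω => ∑ x, (∏ v, P.agentProb (P.beginRound (P.stateAfter T ω) (T + 1))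
      (T + 1) v (x v)) * g (Fin.snoc (α := fun _ => Profile A K) ω x)
    rw [expect]
    convert h using 2 with ω _ ω
    · rw [Finset.mul_sum]
      refine Finset.sum_congr rfl fun x _ => ?_
      have e : (Fin.snocEquiv fun _ : Fin (T + 1) => Profile A K) (x, ω) =
        Fin.snoc (α := fun _ => Profile A K) ω x := rfl
      rw [e, P.law_succ_snoc, ENNReal.toReal_mul, mul_assoc]
      congr 2
      simp only [roundLaw, PMF.ofFintype_apply]
      exact ENNReal.toReal_ofReal (Finset.prod_nonneg fun v _ => P.agentProb_nonneg _ _ v (x v))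
    · funext ω
      refine Finset.sum_congr rfl fun x _ => ?_
      congr 2
      funext i
      refine Fin.lastCases ?_ (fun j => ?_) i
      · simp
      · simp [Function.update_of_ne j.2.ne]

theorem expect_mono {T : ℕ} {g h : (ℕ → Profile A K) → ℝ} (hgh : ∀ ω, g ω ≤ h ω) :
    P.expect T g ≤ P.expect T h := by
  induction T generalizing g h with
  | zero => exact hgh _
  | succ T ih =>
    exact ih fun ω => Finset.sum_le_sum fun x _ =>
      mul_le_mul_of_nonneg_left (hgh _) (P.stepProb_nonneg ω T x)

theorem expect_add (T : ℕ) (g h : (ℕ → Profile A K) → ℝ) :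
    P.expect T (fun ω => g ω + h ω) = P.expect T g + P.expect T h := by
  induction T generalizing g h with
  | zero => rfl
  | succ T ih => simp only [expect, mul_add, Finset.sum_add_distrib, ih]

theorem expect_const_mul (T : ℕ) (c : ℝ) (g : (ℕ → Profile A K) → ℝ) :
    P.expect T (fun ω => c * g ω) = c * P.expect T g := by
  induction T generalizing g with
  | zero => rfl
  | succ T ih =>
    simp only [expect, ← ih, Finset.mul_sum]
    simp only [mul_left_comm]

theorem expect_sub (T : ℕ) (g h : (ℕ → Profile A K) → ℝ) :
    P.expect T (fun ω => g ω - h ω) = P.expect T g - P.expect T h := by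
  have := P.expect_add T g (fun ω => (-1) * h ω)
  rw [expect_const_mul] at this
  simpa [sub_eq_add_neg] using this

theorem expect_const (T : ℕ) (c : ℝ) : P.expect T (fun _ => c) = c := by
  induction T with
  | zero => rfl
  | succ T ih => simp only [expect, ← Finset.sum_mul, sum_stepProb, one_mul, ih]

theorem expect_sum {ι : Type*} (T : ℕ) (s : Finset ι) (g : ι → (ℕ → Profile A K) → ℝ) :
    P.expect T (fun ω => ∑ j ∈ s, g j ω) = ∑ j ∈ s, P.expect T (g j) := by
  induction s using Finset.induction_on with
  | empty => simpa using P.expect_const T 0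
  | insert a s ha ih => simp only [Finset.sum_insert ha, expect_add, ih]

theorem dependsOn_update {g : (ℕ → Profile A K) → ℝ} {t : ℕ} (hg : DependsOn g (Set.Iio t))
    (ω : ℕ → Profile A K) {T : ℕ} (hT : t ≤ T) (x : Profile A K) :
    g (Function.update ω T x) = g ω :=
  hg fun _ hi => Function.update_of_ne (lt_of_lt_of_le hi hT).ne _ _

theorem expect_of_dependsOn {g : (ℕ → Profile A K) → ℝ} {t T : ℕ}
    (hg : DependsOn g (Set.Iio t)) (hT : t ≤ T) : P.expect T g = P.expect t g := by
  induction T, hT using Nat.le_induction with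
  | base => rfl
  | succ T hT ih =>
    simp only [expect, dependsOn_update hg _ hT, ← Finset.sum_mul, sum_stepProb, one_mul, ih]

/-! ### What the state depends on -/

/-- The states `S` and `S'` agree up to the estimates of rounds after `m`. -/
structure AgreeUpTo (m : ℕ) (S S' : State A K) : Prop where
  phase : S.phase = S'.phase
  start : S.start = S'.start
  mass : S.mass = S'.mass
  est : ∀ s ≤ m, S.est s = S'.est s

theorem AgreeUpTo.prob_eq {m : ℕ} {S S' : State A K} (h : AgreeUpTo m S S') {t : ℕ}
    (ht : t ≤ m + P.d + 1) : P.prob S t = P.prob S' t := by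
  have hw : P.weight S t = P.weight S' t := by
    funext i v
    unfold weight
    rw [h.phase, h.start]
    congr 3
    refine Finset.sum_congr rfl fun s hs => ?_
    rw [h.est s (by have := (Finset.mem_Ico.1 hs).2; omega)]
  unfold prob
  rw [hw]

theorem AgreeUpTo.increment_eq {m : ℕ} {S S' : State A K} (h : AgreeUpTo m S S') {t : ℕ}
    (ht : t ≤ m + P.d + 1) : P.increment S t = P.increment S' t := by
  unfold increment
  rw [h.prob_eq P ht, h.start]

theorem AgreeUpTo.beginRound {m : ℕ} {S S' : State A K} (h : AgreeUpTo m S S') {t : ℕ}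
    (ht : t ≤ m + P.d + 1) : AgreeUpTo m (P.beginRound S t) (P.beginRound S' t) := by
  have hi := h.increment_eq P ht
  constructor
  · simp only [Problem.beginRound, hi, h.mass, h.phase]
  · simp only [Problem.beginRound, hi, h.mass, h.phase, h.start]
  · simp only [Problem.beginRound, hi, h.mass, h.phase]
  · exact h.est

/-- The delay in the phase structure: up to round `m + d + 1` only estimates of rounds `≤ m` enter
the weights, hence the increments and phase tests. Paths that differ later can differ only in later
estimates. -/
theorem agreeUpTo_after {m : ℕ} {ω ω' : ℕ → Profile A K} (h : ∀ i < m, ω i = ω' i) {t : ℕ}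
    (ht : t ≤ m + P.d + 1) : AgreeUpTo m (P.after ω t) (P.after ω' t) := by
  induction t with
  | zero => exact ⟨rfl, rfl, rfl, fun _ _ => rfl⟩
  | succ t ih =>
    have h1 : AgreeUpTo m (P.played ω t) (P.played ω' t) :=
      (ih (by omega)).beginRound P ht
    rw [after_succ, after_succ]
    refine ⟨h1.phase, h1.start, ?_, fun s hs => ?_⟩
    · simp only [endRound, h1.mass, h1.increment_eq P ht]
    · simp only [endRound, h1.prob_eq P ht]
      by_cases hst : s = t + 1
      · subst hst
        rw [Function.update_self, Function.update_self, h t (by omega)]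
      · rw [Function.update_of_ne hst, Function.update_of_ne hst, h1.est s hs]

theorem agreeUpTo_played {m : ℕ} {ω ω' : ℕ → Profile A K} (h : ∀ i < m, ω i = ω' i) {t : ℕ}
    (ht : t ≤ m + P.d) : AgreeUpTo m (P.played ω t) (P.played ω' t) :=
  (P.agreeUpTo_after h (by omega)).beginRound P (by omega)

theorem after_congr {ω ω' : ℕ → Profile A K} {t : ℕ} (h : ∀ i < t, ω i = ω' i) :
    P.after ω t = P.after ω' t := by
  unfold after
  congr 1
  funext i
  exact h i i.2

theorem played_congr {ω ω' : ℕ → Profile A K} {t : ℕ} (h : ∀ i < t, ω i = ω' i) :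
    P.played ω t = P.played ω' t := by
  unfold played
  rw [P.after_congr h]

theorem dependsOn_dist (t : ℕ) : DependsOn (fun ω => P.dist ω t) (Set.Iio (t - P.d)) :=
  fun _ _ h => (P.agreeUpTo_played h (by omega)).prob_eq P (by omega)

theorem dependsOn_lossEst (s : ℕ) (i : K) (v : A) :
    DependsOn (fun ω => P.lossEst ω s i v) (Set.Iio s) :=
  fun _ _ h => by simp only [lossEst, P.after_congr h]

theorem after_est (ω : ℕ → Profile A K) {s t : ℕ} (h : s ≤ t) :
    (P.after ω t).est s = P.lossEst ω s := by
  induction t, h using Nat.le_induction with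
  | base => rfl
  | succ t hst ih =>
    rw [after_succ, ← ih]
    exact Function.update_of_ne (by omega) _ _

theorem lossEst_succ (ω : ℕ → Profile A K) (s : ℕ) (i : K) (v : A) :
    P.lossEst ω (s + 1) i v = if P.Observed (ω s) i v then
      P.loss (s + 1) i / P.obsProb (P.dist ω s) i v else 0 := by
  rw [lossEst, after_succ]
  simp only [endRound, Function.update_self]
  rfl

theorem lossEst_nonneg (ω : ℕ → Profile A K) (s : ℕ) (i : K) (v : A) :
    0 ≤ P.lossEst ω s i v := by
  cases s with
  | zero => exact le_rfl
  | succ s =>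
    rw [lossEst_succ]
    split_ifs
    · exact div_nonneg (P.loss_nonneg _ _) (P.obsProb_pos _ _ _ _).le
    · exact le_rfl

theorem dist_pos (ω : ℕ → Profile A K) (t : ℕ) (i : K) (v : A) : 0 < P.dist ω t i v :=
  P.prob_pos _ _ _ _

theorem sum_dist (ω : ℕ → Profile A K) (t : ℕ) (v : A) : ∑ i, P.dist ω t i v = 1 :=
  P.sum_prob _ _ _

/-! ### Conditional expectations of one round -/

theorem sum_stepProb_mul (ω : ℕ → Profile A K) (t : ℕ) (v : A) (φ : Option K → ℝ) :
    ∑ x, P.stepProb ω t x * φ (x v) =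
      ∑ o, P.agentProb (P.played ω t) (t + 1) v o * φ o := by
  have h := sum_prod_profile fun u o =>
    P.agentProb (P.played ω t) (t + 1) u o * if u = v then φ o else 1
  simp only [Finset.prod_mul_distrib] at h
  calc _ = ∑ x : Profile A K, (∏ u, P.agentProb (P.played ω t) (t + 1) u (x u)) *
        ∏ u, (if u = v then φ (x u) else 1) := by
        refine Finset.sum_congr rfl fun x _ => ?_
        rw [Finset.prod_ite_eq' Finset.univ v (fun u => φ (x u))]
        simp [stepProb]
    _ = _ := by
        rw [h, Finset.prod_eq_single v]
        · simp
        · intro u _ hu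
          simp [hu, P.sum_agentProb]
        · simp

/-- The complementary event says that each agent near `v` avoids the actions near `i`; by
independence its probability factors over the agents. -/
theorem sum_stepProb_observed (ω : ℕ → Profile A K) (t : ℕ) (i : K) (v : A) :
    ∑ x, P.stepProb ω t x * (if P.Observed x i v then 1 else 0) =
      P.obsProb (P.dist ω t) i v := by
  have h := sum_prod_profile fun u o =>
    P.agentProb (P.played ω t) (t + 1) u o *
      if u ∈ nbhd P.N P.n v ∧ ∃ j ∈ nbhd P.F P.f i, o = some j then 0 else 1
  simp only [Finset.prod_mul_distrib] at h
  have h1 : ∀ x : Profile A K, (if P.Observed x i v then (1 : ℝ) else 0) = 1 -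
      ∏ u, (if u ∈ nbhd P.N P.n v ∧ ∃ j ∈ nbhd P.F P.f i, x u = some j then 0 else 1) := by
    intro x
    by_cases hx : P.Observed x i v
    · obtain ⟨u, hu⟩ := id hx
      rw [if_pos hx, Finset.prod_eq_zero (Finset.mem_univ u)]
      · simp
      · rw [if_pos hu]
    · rw [if_neg hx, Finset.prod_eq_one]
      · simp
      · intro u _
        exact if_neg fun hu => hx ⟨u, hu⟩
  have h2 : ∀ u, (∑ o, P.agentProb (P.played ω t) (t + 1) u o *
      if u ∈ nbhd P.N P.n v ∧ ∃ j ∈ nbhd P.F P.f i, o = some j then 0 else 1) =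
      if u ∈ nbhd P.N P.n v then 1 - P.q u * ∑ j ∈ nbhd P.F P.f i, P.dist ω t j u else 1 := by
    intro u
    by_cases hu : u ∈ nbhd P.N P.n v
    · have hs := P.sum_dist ω t u
      rw [← Finset.sum_filter_add_sum_filter_not _ (· ∈ nbhd P.F P.f i)] at hs
      rw [Fintype.sum_option]
      simp only [hu, true_and, if_true, agentProb, mul_ite, mul_zero, mul_one]
      simp only [reduceCtorEq, and_false, exists_false, if_false, Option.some.injEq,
        exists_eq_right']
      rw [Finset.sum_ite, Finset.sum_const_zero, zero_add, ← Finset.mul_sum]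
      have h3 : Finset.univ.filter (· ∈ nbhd P.F P.f i) = nbhd P.F P.f i := by ext; simp
      rw [h3] at hs
      have h4 : ∑ j with ¬ j ∈ nbhd P.F P.f i, P.prob (P.played ω t) (t + 1) j u =
        1 - ∑ j ∈ nbhd P.F P.f i, P.dist ω t j u := by
        rw [← hs]; simp [dist]
      rw [h4]
      ring
    · simp [hu, P.sum_agentProb]
  simp only [h1, mul_sub, mul_one, Finset.sum_sub_distrib, sum_stepProb, obsProb]
  congr 1
  refine h.trans ?_
  simp only [h2]
  rw [← Finset.prod_filter]
  congr 1
  ext; simp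

theorem expect_succ_mul_lossEst {h : (ℕ → Profile A K) → ℝ} {s : ℕ}
    (hh : DependsOn h (Set.Iio s)) (i : K) (v : A) :
    P.expect (s + 1) (fun ω => h ω * P.lossEst ω (s + 1) i v) =
      P.expect s (fun ω => h ω * P.loss (s + 1) i) := by
  rw [expect]
  congr 1
  funext ω
  have hd : ∀ x, P.dist (Function.update ω s x) s = P.dist ω s := fun x => by
    unfold dist
    rw [P.played_congr fun j hj => Function.update_of_ne hj.ne _ _]
  simp only [dependsOn_update hh _ le_rfl, lossEst_succ, hd, Function.update_self]
  have hb : P.obsProb (P.dist ω s) i v ≠ 0 := (P.obsProb_pos _ _ _ _).ne'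
  calc _ = (∑ x, P.stepProb ω s x * (if P.Observed x i v then 1 else 0)) *
        (h ω * (P.loss (s + 1) i / P.obsProb (P.dist ω s) i v)) := by
        rw [Finset.sum_mul]
        refine Finset.sum_congr rfl fun x _ => ?_
        split_ifs <;> ring
    _ = _ := by
        rw [sum_stepProb_observed]
        field_simp

/-- The squared estimate is `(ℓ / b) ^ 2` on an event of probability `b`, so its conditional mean is
`ℓ ^ 2 / b ≤ 1 / b`. -/
theorem expect_succ_mul_lossEst_sq {h : (ℕ → Profile A K) → ℝ} {s : ℕ}
    (hh : DependsOn h (Set.Iio s)) (h0 : ∀ ω, 0 ≤ h ω) (i : K) (v : A) :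
    P.expect (s + 1) (fun ω => h ω * (P.lossEst ω (s + 1) i v * P.lossEst ω (s + 1) i v)) ≤
      P.expect s (fun ω => h ω / P.obsProb (P.dist ω s) i v) := by
  rw [expect]
  refine P.expect_mono fun ω => ?_
  have hd : ∀ x, P.dist (Function.update ω s x) s = P.dist ω s := fun x => by
    unfold dist
    rw [P.played_congr fun j hj => Function.update_of_ne hj.ne _ _]
  simp only [dependsOn_update hh _ le_rfl, lossEst_succ, hd, Function.update_self]
  have hb : 0 < P.obsProb (P.dist ω s) i v := P.obsProb_pos _ _ _ _
  calc _ = (∑ x, P.stepProb ω s x * (if P.Observed x i v then 1 else 0)) *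
        (h ω * (P.loss (s + 1) i / P.obsProb (P.dist ω s) i v *
          (P.loss (s + 1) i / P.obsProb (P.dist ω s) i v))) := by
        rw [Finset.sum_mul]
        refine Finset.sum_congr rfl fun x _ => ?_
        split_ifs <;> ring
    _ = P.loss (s + 1) i * P.loss (s + 1) i * (h ω / P.obsProb (P.dist ω s) i v) := by
        rw [sum_stepProb_observed]
        field_simp
    _ ≤ 1 * (h ω / P.obsProb (P.dist ω s) i v) := by
        refine mul_le_mul_of_nonneg_right ?_ (div_nonneg (h0 ω) hb.le)
        exact mul_le_one₀ (P.loss_le_one _ _) (P.loss_nonneg _ _) (P.loss_le_one _ _)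
    _ = _ := one_mul _

theorem expect_succ_outcome (t : ℕ) (v : A) (φ : Option K → ℝ) :
    P.expect (t + 1) (fun ω => φ (ω t v)) =
      P.expect t (fun ω => ∑ o, P.agentProb (P.played ω t) (t + 1) v o * φ o) := by
  rw [expect]
  simp only [Function.update_self, sum_stepProb_mul]

end CoopLearning.Problem

/-! ### Exponential weights with delayed losses -/

namespace CoopLearning

/-- One round of exponential weights with delay: `c` are the cumulative losses in use, `m` the
losses that have not arrived yet, and `e` those of the current round. -/
theorem exp_weights_step {K : Type*} [Fintype K] [Nonempty K] {η : ℝ} (hη : 0 < η)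
    (c m e : K → ℝ) (hm : ∀ i, 0 ≤ m i) (he : ∀ i, 0 ≤ e i) :
    ∑ i, Real.exp (-(η * c i)) / (∑ j, Real.exp (-(η * c j))) * e i ≤
      (Real.log (∑ i, Real.exp (-(η * (c i + m i)))) -
        Real.log (∑ i, Real.exp (-(η * (c i + m i + e i))))) / η +
      η * ∑ i, Real.exp (-(η * c i)) / (∑ j, Real.exp (-(η * c j))) * (m i + e i) * e i := by
  have pos : ∀ x : K → ℝ, 0 < ∑ i, Real.exp (-(η * x i)) := fun x =>
    Finset.sum_pos (fun _ _ => Real.exp_pos _) Finset.univ_nonempty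
  set W := ∑ j, Real.exp (-(η * c j)) with hW
  set W₁ := ∑ i, Real.exp (-(η * (c i + m i))) with hW₁
  set W₂ := ∑ i, Real.exp (-(η * (c i + m i + e i))) with hW₂
  have h0 : 0 < W := pos c
  have h1 : 0 < W₁ := pos fun i => c i + m i
  have h2 : 0 < W₂ := pos fun i => c i + m i + e i
  set p : K → ℝ := fun i => Real.exp (-(η * c i)) / W with hp
  set p' : K → ℝ := fun i => Real.exp (-(η * (c i + m i + e i))) / W₂ with hp'
  have hp0 : ∀ i, 0 ≤ p i := fun i => (div_pos (Real.exp_pos _) h0).le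
  have hp'0 : ∀ i, 0 ≤ p' i := fun i => (div_pos (Real.exp_pos _) h2).le
  -- Extra losses lower the total weight, so passing from `p` to the fully informed `p'` costs at
  -- most the factor `exp (-η (m + e)) ≥ 1 - η (m + e)`. No upper bound on `η (m + e)` is needed.
  have hle : W₂ ≤ W := Finset.sum_le_sum fun i _ => Real.exp_le_exp.2 <| by
    nlinarith [mul_nonneg hη.le (hm i), mul_nonneg hη.le (he i)]
  have drift : ∀ i, p i * (1 - η * (m i + e i)) ≤ p' i := by
    intro i
    have e1 : Real.exp (-(η * (c i + m i + e i))) =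
        Real.exp (-(η * c i)) * Real.exp (-(η * (m i + e i))) := by
      rw [← Real.exp_add]; ring_nf
    calc p i * (1 - η * (m i + e i)) ≤ p i * Real.exp (-(η * (m i + e i))) := by
          refine mul_le_mul_of_nonneg_left ?_ (hp0 i)
          linarith [Real.add_one_le_exp (-(η * (m i + e i)))]
      _ = Real.exp (-(η * (c i + m i + e i))) / W := by
          simp only [hp, e1]; ring
      _ ≤ p' i := div_le_div_of_nonneg_left (Real.exp_pos _).le h2 hle
  -- `W₁ / W₂` is the `p'`-mean of `exp (η e)`; Jensen's inequality is proved through the tangent of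
  -- `exp` at the mean `x`.
  have btl : η * ∑ i, p' i * e i ≤ Real.log W₁ - Real.log W₂ := by
    rw [← Real.log_div h1.ne' h2.ne', Real.le_log_iff_exp_le (div_pos h1 h2)]
    set x := η * ∑ i, p' i * e i with hx
    have hsum : ∑ i, p' i = 1 := by
      simp only [hp']
      rw [← Finset.sum_div]
      exact div_self h2.ne'
    have e2 : W₁ / W₂ = ∑ i, p' i * Real.exp (η * e i) := by
      rw [hW₁, Finset.sum_div]
      refine Finset.sum_congr rfl fun i _ => ?_
      simp only [hp']
      rw [div_mul_eq_mul_div, ← Real.exp_add]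
      ring_nf
    have e3 : ∀ i, Real.exp x * (1 + (η * e i - x)) ≤ Real.exp (η * e i) := by
      intro i
      have : Real.exp (η * e i) = Real.exp x * Real.exp (η * e i - x) := by
        rw [← Real.exp_add]; ring_nf
      rw [this]
      refine mul_le_mul_of_nonneg_left ?_ (Real.exp_pos x).le
      linarith [Real.add_one_le_exp (η * e i - x)]
    rw [e2]
    calc Real.exp x = Real.exp x * ((1 - x) * ∑ i, p' i + η * ∑ i, p' i * e i) := by
          rw [hsum, ← hx]; ring
      _ = ∑ i, p' i * (Real.exp x * (1 + (η * e i - x))) := by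
          rw [Finset.mul_sum, Finset.mul_sum, ← Finset.sum_add_distrib, Finset.mul_sum]
          exact Finset.sum_congr rfl fun i _ => by ring
      _ ≤ _ := Finset.sum_le_sum fun i _ => mul_le_mul_of_nonneg_left (e3 i) (hp'0 i)
  have hd : ∑ i, p i * e i ≤ ∑ i, p' i * e i + η * ∑ i, p i * (m i + e i) * e i := by
    rw [Finset.mul_sum, ← Finset.sum_add_distrib]
    refine Finset.sum_le_sum fun i _ => ?_
    nlinarith [mul_le_mul_of_nonneg_right (drift i) (he i)]
  have hb : ∑ i, p' i * e i ≤ (Real.log W₁ - Real.log W₂) / η := by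
    rw [le_div_iff₀ hη]; linarith
  linarith

namespace Problem

open Classical

set_option linter.unusedSectionVars false

variable {A K : Type*} [Fintype A] [Fintype K] [Nonempty K] (P : Problem A K)

/-! ### The expected drift -/

/-- Round `t + 1` is neither one of the first `d + 1` rounds of the current phase of `v` nor one in
which the sum of the `X_{r,s}` exceeds its limit. -/
def RegularRound (ω : ℕ → Profile A K) (t : ℕ) (v : A) : Prop :=
  (P.played ω t).start v + P.d < t + 1 ∧
    (P.played ω t).mass v + P.increment (P.played ω t) (t + 1) v ≤ 2 ^ (P.played ω t).phase v

/-- The learning rate in regular rounds, and `0` in the others. -/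
noncomputable def regularRate (ω : ℕ → Profile A K) (t : ℕ) (v : A) : ℝ :=
  if P.RegularRound ω t v then rate K ((P.played ω t).phase v) else 0

/-- The indicator of the rounds that are not regular. -/
noncomputable def irregular (ω : ℕ → Profile A K) (t : ℕ) (v : A) : ℝ :=
  if P.RegularRound ω t v then 0 else 1

/-- The price of the delay, in terms of the estimates. -/
noncomputable def drift (ω : ℕ → Profile A K) (t : ℕ) (v : A) : ℝ :=
  P.regularRate ω t v * ∑ i, P.dist ω t i v *
      ((∑ s ∈ Finset.Ico (t + 1 - P.d) (t + 1), P.lossEst ω s i v) + P.lossEst ω (t + 1) i v) *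
      P.lossEst ω (t + 1) i v +
    P.irregular ω t v * ∑ i, P.dist ω t i v * P.lossEst ω (t + 1) i v

/-- The bound on the expectation of `drift`. -/
noncomputable def driftBound (ω : ℕ → Profile A K) (t : ℕ) (v : A) : ℝ :=
  P.regularRate ω t v * (P.d + ∑ i, P.dist ω t i v / P.obsProb (P.dist ω t) i v) +
    P.irregular ω t v

theorem rate_nonneg (r : ℕ) : 0 ≤ rate K r := Real.sqrt_nonneg _

theorem regularRate_nonneg (ω : ℕ → Profile A K) (t : ℕ) (v : A) :
    0 ≤ P.regularRate ω t v := by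
  unfold regularRate
  split_ifs
  exacts [rate_nonneg _, le_rfl]

theorem irregular_nonneg (ω : ℕ → Profile A K) (t : ℕ) (v : A) : 0 ≤ P.irregular ω t v := by
  unfold irregular
  split_ifs
  exacts [le_rfl, zero_le_one]

/-- Regularity is decided before the missing losses are drawn, so the rates and indicators act as
constants when those are averaged. -/
theorem regularRound_congr {ω ω' : ℕ → Profile A K} {t : ℕ} (h : ∀ i < t - P.d, ω i = ω' i)
    (v : A) : P.RegularRound ω t v ↔ P.RegularRound ω' t v := by
  have h1 := P.agreeUpTo_played h (t := t) (by omega)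
  unfold RegularRound
  rw [h1.increment_eq P (by omega), h1.start, h1.mass, h1.phase]

theorem dependsOn_regularRate (t : ℕ) (v : A) :
    DependsOn (fun ω => P.regularRate ω t v) (Set.Iio (t - P.d)) := fun ω ω' h => by
  have h1 := P.agreeUpTo_played h (t := t) (by omega)
  simp only [regularRate, P.regularRound_congr h, h1.phase]

theorem dependsOn_irregular (t : ℕ) (v : A) :
    DependsOn (fun ω => P.irregular ω t v) (Set.Iio (t - P.d)) := fun ω ω' h => by
  simp only [irregular, P.regularRound_congr h]

/-- Average over round `t + 1` first, with the estimate of round `s` as a known factor, then over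
round `s`, with `h` known. Each average replaces an estimate by a loss of at most 1. -/
theorem expect_mul_lossEst_mul_lossEst {h : (ℕ → Profile A K) → ℝ} {t s : ℕ}
    (hh : DependsOn h (Set.Iio (t - P.d))) (h0 : ∀ ω, 0 ≤ h ω)
    (hs : s ∈ Finset.Ico (t + 1 - P.d) (t + 1)) (i : K) (v : A) :
    P.expect (t + 1) (fun ω => h ω * P.lossEst ω s i v * P.lossEst ω (t + 1) i v) ≤
      P.expect t h := by
  rw [Finset.mem_Ico] at hs
  rw [P.expect_succ_mul_lossEst]
  swap
  · intro ω ω' e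
    have e1 : h ω = h ω' := hh fun j hj => e j (by simp only [Set.mem_Iio] at *; omega)
    have e2 : P.lossEst ω s i v = P.lossEst ω' s i v :=
      P.dependsOn_lossEst s i v fun j hj => e j (by simp only [Set.mem_Iio] at *; omega)
    simp only [e1, e2]
  have h1 : P.expect t (fun ω => h ω * P.lossEst ω s i v * P.loss (t + 1) i) ≤
      P.expect t (fun ω => h ω * P.lossEst ω s i v) := P.expect_mono fun ω =>
    mul_le_of_le_one_right (mul_nonneg (h0 ω) (P.lossEst_nonneg _ _ _ _)) (P.loss_le_one _ _)
  refine h1.trans ?_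
  cases s with
  -- There is no round `0`: this index arises from truncated subtraction when `t + 1 ≤ d`, and its
  -- estimate is the initial value `0`.
  | zero =>
    refine P.expect_mono fun ω => ?_
    have : P.lossEst ω 0 i v = 0 := rfl
    rw [this, mul_zero]
    exact h0 ω
  | succ s =>
    have hh' : DependsOn h (Set.Iio s) := hh.mono (Set.Iio_subset_Iio (by omega))
    rw [P.expect_of_dependsOn (t := s + 1) (T := t) _ (by omega),
      P.expect_succ_mul_lossEst hh', P.expect_of_dependsOn hh' (T := t) (by omega)]
    · exact P.expect_mono fun ω => mul_le_of_le_one_right (h0 ω) (P.loss_le_one _ _)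
    · intro ω ω' e
      have e1 : h ω = h ω' := hh' fun j hj => e j (by simp only [Set.mem_Iio] at *; omega)
      have e2 : P.lossEst ω (s + 1) i v = P.lossEst ω' (s + 1) i v :=
        P.dependsOn_lossEst (s + 1) i v e
      simp only [e1, e2]

theorem dependsOn_mul_dist {h : (ℕ → Profile A K) → ℝ} {t : ℕ}
    (hh : DependsOn h (Set.Iio (t - P.d))) (i : K) (v : A) :
    DependsOn (fun ω => h ω * P.dist ω t i v) (Set.Iio (t - P.d)) := fun ω ω' e => by
  have := P.dependsOn_dist t e
  simp only at this
  simp only [this, hh e]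

theorem expect_drift_le (t : ℕ) (v : A) :
    P.expect (t + 1) (fun ω => P.drift ω t v) ≤ P.expect t fun ω => P.driftBound ω t v := by
  have hg := P.dependsOn_mul_dist (P.dependsOn_regularRate t v)
  have hb := P.dependsOn_mul_dist (P.dependsOn_irregular t v)
  have hg0 : ∀ i ω, 0 ≤ P.regularRate ω t v * P.dist ω t i v := fun i ω =>
    mul_nonneg (P.regularRate_nonneg _ _ _) (P.dist_pos _ _ _ _).le
  have hb0 : ∀ i ω, 0 ≤ P.irregular ω t v * P.dist ω t i v := fun i ω =>
    mul_nonneg (P.irregular_nonneg _ _ _) (P.dist_pos _ _ _ _).le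
  have sub : Set.Iio (t - P.d) ⊆ Set.Iio t := Set.Iio_subset_Iio (by omega)
  have e1 : (fun ω => P.drift ω t v) = fun ω => ∑ i,
      ((∑ s ∈ Finset.Ico (t + 1 - P.d) (t + 1),
        P.regularRate ω t v * P.dist ω t i v * P.lossEst ω s i v * P.lossEst ω (t + 1) i v) +
      (P.regularRate ω t v * P.dist ω t i v *
        (P.lossEst ω (t + 1) i v * P.lossEst ω (t + 1) i v) +
      P.irregular ω t v * P.dist ω t i v * P.lossEst ω (t + 1) i v)) := by
    funext ω
    unfold drift
    rw [Finset.mul_sum, Finset.mul_sum, ← Finset.sum_add_distrib]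
    refine Finset.sum_congr rfl fun i _ => ?_
    rw [← Finset.sum_mul, ← Finset.mul_sum]
    ring
  have e2 : (fun ω => P.driftBound ω t v) = fun ω => ∑ i,
      (P.d * (P.regularRate ω t v * P.dist ω t i v) +
      (P.regularRate ω t v * P.dist ω t i v / P.obsProb (P.dist ω t) i v +
      P.irregular ω t v * P.dist ω t i v)) := by
    funext ω
    unfold driftBound
    rw [Finset.sum_add_distrib, Finset.sum_add_distrib, ← Finset.mul_sum, ← Finset.mul_sum,
      ← Finset.mul_sum, sum_dist]
    simp only [mul_div_assoc]
    rw [← Finset.mul_sum]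
    ring
  rw [e1, e2, expect_sum, expect_sum]
  refine Finset.sum_le_sum fun i _ => ?_
  simp only [expect_add, expect_sum]
  refine add_le_add ?_ (add_le_add ?_ ?_)
  · refine (Finset.sum_le_sum fun s hs =>
      P.expect_mul_lossEst_mul_lossEst (hg i v) (hg0 i) hs i v).trans ?_
    rw [Finset.sum_const, nsmul_eq_mul, expect_const_mul]
    refine mul_le_mul_of_nonneg_right ?_ ?_
    · rw [Nat.card_Ico]
      exact_mod_cast (by omega : t + 1 - (t + 1 - P.d) ≤ P.d)
    · have := P.expect_mono (T := t) (hg0 i)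
      rwa [expect_const] at this
  · exact P.expect_succ_mul_lossEst_sq ((hg i v).mono sub) (hg0 i) i v
  · rw [P.expect_succ_mul_lossEst ((hb i v).mono sub)]
    exact P.expect_mono fun ω => mul_le_of_le_one_right (hb0 i ω) (P.loss_le_one _ _)

/-! ### The regret along a path -/

theorem start_after_le (ω : ℕ → Profile A K) (t : ℕ) (v : A) :
    (P.after ω t).start v ≤ t + 1 := by
  induction t with
  | zero => exact le_rfl
  | succ t ih =>
    have : (P.after ω (t + 1)).start v = (P.played ω t).start v := rfl
    rw [this]
    simp only [played, beginRound]
    split_ifs <;> omega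

theorem start_played_le (ω : ℕ → Profile A K) (t : ℕ) (v : A) :
    (P.played ω t).start v ≤ t + 1 := by
  have := P.start_after_le ω t v
  simp only [played, beginRound]
  split_ifs <;> omega

/-- The potential of a phase `r` that started in round `a`, just before round `b`, minus the
estimated cumulative loss of action `k` in this phase. -/
noncomputable def potential (ω : ℕ → Profile A K) (v : A) (k : K) (r a b : ℕ) : ℝ :=
  (Real.log (Fintype.card K) -
      Real.log (∑ i, Real.exp (-(rate K r * ∑ s ∈ Finset.Ico a b, P.lossEst ω s i v)))) / rate K r
    - ∑ s ∈ Finset.Ico a b, P.lossEst ω s k v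

theorem potential_self (ω : ℕ → Profile A K) (v : A) (k : K) (r a : ℕ) :
    P.potential ω v k r a a = 0 := by
  simp [potential]

theorem rate_pos (hK : 1 < Fintype.card K) (r : ℕ) : 0 < rate K r :=
  Real.sqrt_pos.2 (div_pos (Real.log_pos (by exact_mod_cast hK)) (by positivity))

theorem potential_le (hK : 1 < Fintype.card K) (ω : ℕ → Profile A K) (v : A) (k : K)
    (r a b : ℕ) : P.potential ω v k r a b ≤ Real.log (Fintype.card K) / rate K r := by
  have hη := rate_pos hK r
  have h1 : Real.exp (-(rate K r * ∑ s ∈ Finset.Ico a b, P.lossEst ω s k v)) ≤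
      ∑ i, Real.exp (-(rate K r * ∑ s ∈ Finset.Ico a b, P.lossEst ω s i v)) :=
    Finset.single_le_sum
      (f := fun i => Real.exp (-(rate K r * ∑ s ∈ Finset.Ico a b, P.lossEst ω s i v)))
      (fun i _ => (Real.exp_pos _).le) (Finset.mem_univ k)
  have h2 := Real.log_le_log (Real.exp_pos _) h1
  rw [Real.log_exp] at h2
  unfold potential
  rw [sub_le_iff_le_add, ← sub_le_iff_le_add', ← sub_div, div_le_iff₀ hη]
  linarith

theorem potential_step (hK : 1 < Fintype.card K) (ω : ℕ → Profile A K) (v : A) (k : K)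
    {r a b : ℕ} (hab : a ≤ b) :
    P.potential ω v k r a b - P.lossEst ω b k v ≤ P.potential ω v k r a (b + 1) := by
  have hη := rate_pos hK r
  unfold potential
  rw [Finset.sum_Ico_succ_top hab (fun s => P.lossEst ω s k v)]
  have h1 : ∑ i, Real.exp (-(rate K r * ∑ s ∈ Finset.Ico a (b + 1), P.lossEst ω s i v)) ≤
      ∑ i, Real.exp (-(rate K r * ∑ s ∈ Finset.Ico a b, P.lossEst ω s i v)) := by
    refine Finset.sum_le_sum fun i _ => Real.exp_le_exp.2 (neg_le_neg ?_)
    refine mul_le_mul_of_nonneg_left ?_ hη.le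
    rw [Finset.sum_Ico_succ_top hab]
    linarith [P.lossEst_nonneg ω b i v]
  have h2 := Real.log_le_log
    (Finset.sum_pos (fun _ _ => Real.exp_pos _) Finset.univ_nonempty) h1
  have h3 := div_le_div_of_nonneg_right (sub_le_sub_left h2 (Real.log (Fintype.card K))) hη.le
  linarith

theorem dist_eq (ω : ℕ → Profile A K) (t : ℕ) (i : K) (v : A) :
    P.dist ω t i v =
      Real.exp (-(rate K ((P.played ω t).phase v) *
          ∑ s ∈ Finset.Ico ((P.played ω t).start v) (t + 1 - P.d), P.lossEst ω s i v)) /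
        ∑ j, Real.exp (-(rate K ((P.played ω t).phase v) *
          ∑ s ∈ Finset.Ico ((P.played ω t).start v) (t + 1 - P.d), P.lossEst ω s j v)) := by
  have h : ∀ j, P.weight (P.played ω t) (t + 1) j v =
      Real.exp (-(rate K ((P.played ω t).phase v) *
        ∑ s ∈ Finset.Ico ((P.played ω t).start v) (t + 1 - P.d), P.lossEst ω s j v)) := by
    intro j
    unfold weight
    congr 3
    refine Finset.sum_congr rfl fun s hs => ?_
    rw [← P.after_est ω (s := s) (t := t) (by have := (Finset.mem_Ico.1 hs).2; omega)]
    rfl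
  unfold dist prob
  simp only [h]

/-- In a regular round the phase began before the window of missing rounds, so `exp_weights_step`
applies to three consecutive blocks of estimates. In an irregular round `drift` cancels the whole
estimated loss of the agent, and monotonicity of the total weight suffices. -/
theorem potential_step_drift (hK : 1 < Fintype.card K) (ω : ℕ → Profile A K) (v : A) (k : K)
    (t : ℕ) :
    P.potential ω v k ((P.played ω t).phase v) ((P.played ω t).start v) (t + 1) +
        (∑ i, P.dist ω t i v * P.lossEst ω (t + 1) i v - P.lossEst ω (t + 1) k v -
          P.drift ω t v) ≤
      P.potential ω v k ((P.played ω t).phase v) ((P.played ω t).start v) (t + 2) := by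
  have ha := P.start_played_le ω t v
  by_cases hr : P.RegularRound ω t v
  · have hη := rate_pos hK ((P.played ω t).phase v)
    have ha' : (P.played ω t).start v ≤ t + 1 - P.d := by have := hr.1; omega
    have h := exp_weights_step hη
      (fun i => ∑ s ∈ Finset.Ico ((P.played ω t).start v) (t + 1 - P.d), P.lossEst ω s i v)
      (fun i => ∑ s ∈ Finset.Ico (t + 1 - P.d) (t + 1), P.lossEst ω s i v)
      (fun i => P.lossEst ω (t + 1) i v)
      (fun i => Finset.sum_nonneg fun s _ => P.lossEst_nonneg ω s i v)
      (fun i => P.lossEst_nonneg ω (t + 1) i v)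
    simp only [← P.dist_eq,
      Finset.sum_Ico_consecutive _ ha' (by omega : t + 1 - P.d ≤ t + 1),
      ← Finset.sum_Ico_succ_top ha] at h
    unfold drift regularRate irregular potential
    rw [if_pos hr, if_pos hr, Finset.sum_Ico_succ_top ha (fun s => P.lossEst ω s k v)]
    rw [sub_div] at h ⊢
    rw [sub_div]
    linarith
  · have h := P.potential_step hK ω v k (r := (P.played ω t).phase v) ha
    unfold drift regularRate irregular
    rw [if_neg hr, if_neg hr]
    linarith

/-- Telescoping: at a phase change the old potential is at most `ln |K| / η_r` and the new one
starts at 0. Counting from phase `0` rather than `r₀` only weakens the bound. -/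
theorem sum_regret_sub_drift_le (hK : 1 < Fintype.card K) (ω : ℕ → Profile A K) (v : A) (k : K)
    (T : ℕ) :
    ∑ t ∈ Finset.range T, (∑ i, P.dist ω t i v * P.lossEst ω (t + 1) i v -
        P.lossEst ω (t + 1) k v - P.drift ω t v) ≤
      ∑ r ∈ Finset.range ((P.after ω T).phase v), Real.log (Fintype.card K) / rate K r +
        P.potential ω v k ((P.after ω T).phase v) ((P.after ω T).start v) (T + 1) := by
  induction T with
  | zero =>
    have : (P.after ω 0).start v = 0 + 1 := rfl
    rw [this, potential_self, Finset.range_zero, Finset.sum_empty, add_zero]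
    exact Finset.sum_nonneg fun r _ =>
      div_nonneg (Real.log_natCast_nonneg _) (rate_nonneg r)
  | succ T ih =>
    have hs : (P.after ω (T + 1)).start v = (P.played ω T).start v := rfl
    have hp : (P.after ω (T + 1)).phase v = (P.played ω T).phase v := rfl
    have hstep := P.potential_step_drift hK ω v k T
    rw [Finset.sum_range_succ, hs, hp]
    suffices h : ∑ r ∈ Finset.range ((P.after ω T).phase v),
          Real.log (Fintype.card K) / rate K r +
        P.potential ω v k ((P.after ω T).phase v) ((P.after ω T).start v) (T + 1) ≤
        ∑ r ∈ Finset.range ((P.played ω T).phase v), Real.log (Fintype.card K) / rate K r +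
        P.potential ω v k ((P.played ω T).phase v) ((P.played ω T).start v) (T + 1) by
      linarith
    simp only [played, beginRound]
    split_ifs
    · exact le_rfl
    · rw [potential_self, Finset.sum_range_succ]
      linarith [P.potential_le hK ω v k ((P.after ω T).phase v) ((P.after ω T).start v) (T + 1)]

/-! ### Phase budgets and the index of the last phase -/

/-- The drift bounds of the current phase, in terms of the state at the end of round `T`. -/
noncomputable def phaseCost (S : State A K) (T : ℕ) (v : A) : ℝ :=
  rate K (S.phase v) * min (S.mass v) (2 ^ S.phase v) +
    ((min (T + 1 - S.start v) (P.d + 1) : ℕ) : ℝ) + if S.mass v ≤ 2 ^ S.phase v then 0 else 1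

theorem phaseCost_le (S : State A K) (T : ℕ) (v : A) :
    P.phaseCost S T v ≤ rate K (S.phase v) * 2 ^ S.phase v + (P.d + 2) := by
  unfold phaseCost
  have h1 := mul_le_mul_of_nonneg_left (min_le_right (S.mass v) (2 ^ S.phase v))
    (rate_nonneg (K := K) (S.phase v))
  have h2 : ((min (T + 1 - S.start v) (P.d + 1) : ℕ) : ℝ) ≤ P.d + 1 := by
    exact_mod_cast min_le_right _ _
  have h3 : (if S.mass v ≤ 2 ^ S.phase v then (0 : ℝ) else 1) ≤ 1 := by
    split_ifs <;> norm_num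
  linarith

theorem phaseCost_nonneg (S : State A K) (T : ℕ) (v : A) (h : 0 ≤ S.mass v) :
    0 ≤ P.phaseCost S T v := by
  unfold phaseCost
  have h1 : 0 ≤ min (S.mass v) (2 ^ S.phase v) := le_min h (by positivity)
  have h2 : (0 : ℝ) ≤ if S.mass v ≤ 2 ^ S.phase v then 0 else 1 := by
    split_ifs <;> norm_num
  have := rate_nonneg (K := K) (S.phase v)
  positivity

/-- Each round is charged to one term of `phaseCost`: a regular round to the mass, an early one to
the counter capped at `d + 1`, an overrun to the indicator. -/
theorem driftBound_add_phaseCost_le (ω : ℕ → Profile A K) (t : ℕ) (v : A)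
    (hm : (P.played ω t).mass v ≤ 2 ^ (P.played ω t).phase v) :
    P.phaseCost (P.played ω t) t v + P.driftBound ω t v ≤
      P.phaseCost (P.after ω (t + 1)) (t + 1) v := by
  have ha := P.start_played_le ω t v
  have hs : (P.after ω (t + 1)).start v = (P.played ω t).start v := rfl
  have hp : (P.after ω (t + 1)).phase v = (P.played ω t).phase v := rfl
  have hmass : (P.after ω (t + 1)).mass v =
    (P.played ω t).mass v + P.increment (P.played ω t) (t + 1) v := rfl
  have hX := P.increment_nonneg (P.played ω t) (t + 1) v
  unfold phaseCost driftBound regularRate irregular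
  rw [hs, hp, hmass, min_eq_left hm]
  by_cases h1 : (P.played ω t).start v + P.d < t + 1
  · have e1 : min (t + 1 - (P.played ω t).start v) (P.d + 1) = P.d + 1 := by omega
    have e2 : min (t + 1 + 1 - (P.played ω t).start v) (P.d + 1) = P.d + 1 := by omega
    rw [e1, e2, if_pos hm]
    by_cases h2 : (P.played ω t).mass v + P.increment (P.played ω t) (t + 1) v ≤
        2 ^ (P.played ω t).phase v
    · have hr : P.RegularRound ω t v := ⟨h1, h2⟩
      rw [if_pos hr, if_pos hr, if_pos h2, min_eq_left h2]
      have : P.increment (P.played ω t) (t + 1) v =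
          P.d + ∑ i, P.dist ω t i v / P.obsProb (P.dist ω t) i v := if_pos h1
      rw [this]
      linarith
    · have hr : ¬ P.RegularRound ω t v := fun h => h2 h.2
      rw [if_neg hr, if_neg hr, if_neg h2, min_eq_right (not_le.1 h2).le]
      have := mul_le_mul_of_nonneg_left hm (rate_nonneg (K := K) ((P.played ω t).phase v))
      linarith
  · have hr : ¬ P.RegularRound ω t v := fun h => h1 h.1
    have e0 : P.increment (P.played ω t) (t + 1) v = 0 := if_neg h1
    have e1 : min (t + 1 + 1 - (P.played ω t).start v) (P.d + 1) =
      min (t + 1 - (P.played ω t).start v) (P.d + 1) + 1 := by omega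
    rw [if_neg hr, if_neg hr, e0, add_zero, if_pos hm, min_eq_left hm, e1]
    push_cast
    linarith

/-- This is why a phase is overrun at most once: increments are nonnegative, so after an overrun the
next test must fail. -/
theorem mass_played_le (ω : ℕ → Profile A K) (t : ℕ) (v : A) :
    (P.played ω t).mass v ≤ 2 ^ (P.played ω t).phase v := by
  have := P.increment_nonneg (P.after ω t) (t + 1) v
  simp only [played, beginRound]
  split_ifs with h
  · linarith
  · positivity

theorem sum_driftBound_le (ω : ℕ → Profile A K) (v : A) (T : ℕ) :
    ∑ t ∈ Finset.range T, P.driftBound ω t v ≤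
      ∑ r ∈ Finset.range ((P.after ω T).phase v), (rate K r * 2 ^ r + (P.d + 2)) +
        P.phaseCost (P.after ω T) T v := by
  induction T with
  | zero =>
    have h1 := P.phaseCost_nonneg (P.after ω 0) 0 v (le_refl 0)
    refine add_nonneg (Finset.sum_nonneg fun r _ => ?_) h1
    have := rate_nonneg (K := K) r
    positivity
  | succ T ih =>
    have hp : (P.after ω (T + 1)).phase v = (P.played ω T).phase v := rfl
    have hstep := P.driftBound_add_phaseCost_le ω T v (P.mass_played_le ω T v)
    rw [Finset.sum_range_succ, hp]
    suffices h : ∑ r ∈ Finset.range ((P.after ω T).phase v),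
          (rate K r * 2 ^ r + (P.d + 2 : ℝ)) + P.phaseCost (P.after ω T) T v ≤
        ∑ r ∈ Finset.range ((P.played ω T).phase v), (rate K r * 2 ^ r + (P.d + 2 : ℝ)) +
        P.phaseCost (P.played ω T) T v by
      linarith
    by_cases h : (P.after ω T).mass v + P.increment (P.after ω T) (T + 1) v ≤
        2 ^ (P.after ω T).phase v
    · have e1 : (P.played ω T).phase v = (P.after ω T).phase v := if_pos h
      have e2 : (P.played ω T).start v = (P.after ω T).start v := if_pos h
      have e3 : (P.played ω T).mass v = (P.after ω T).mass v := if_pos h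
      simp only [phaseCost, e1, e2, e3, le_refl]
    · have e1 : (P.played ω T).phase v = (P.after ω T).phase v + 1 := if_neg h
      have e3 : (P.played ω T).mass v = 0 := if_neg h
      have := P.phaseCost_nonneg (P.played ω T) T v e3.ge
      rw [e1, Finset.sum_range_succ]
      linarith [P.phaseCost_le (P.after ω T) T v]

/-- The sum of all `X_{r,s}` and `X'_{r,s}` of the agent `v` in the rounds `1, …, T`. -/
noncomputable def totalIncrement (ω : ℕ → Profile A K) (v : A) (T : ℕ) : ℝ :=
  ∑ t ∈ Finset.range T,
    (P.increment (P.after ω t) (t + 1) v + P.increment (P.played ω t) (t + 1) v)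

/-- A phase ends because incurred `X` plus one hypothetical `X'` exceed `2 ^ r`. The two may differ
when others change phase, so `totalIncrement` contains both. -/
theorem two_pow_phase_le (ω : ℕ → Profile A K) (v : A) (T : ℕ) :
    (P.after ω T).mass v ≤ P.totalIncrement ω v T ∧
      (2 : ℝ) ^ (P.after ω T).phase v ≤ 2 ^ firstPhase K + 2 * P.totalIncrement ω v T := by
  induction T with
  | zero => exact ⟨le_of_eq (by simp [totalIncrement, after_zero, initialState]),
      le_of_eq (by simp [totalIncrement, after_zero, initialState])⟩
  | succ T ih =>
    have hmass : (P.after ω (T + 1)).mass v =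
      (P.played ω T).mass v + P.increment (P.played ω T) (T + 1) v := rfl
    have hp : (P.after ω (T + 1)).phase v = (P.played ω T).phase v := rfl
    have h0 := P.increment_nonneg (P.after ω T) (T + 1) v
    have h1 := P.increment_nonneg (P.played ω T) (T + 1) v
    have hT : P.totalIncrement ω v (T + 1) = P.totalIncrement ω v T +
      (P.increment (P.after ω T) (T + 1) v + P.increment (P.played ω T) (T + 1) v) :=
      Finset.sum_range_succ _ _
    have hn : 0 ≤ P.totalIncrement ω v T := Finset.sum_nonneg fun t _ =>
      add_nonneg (P.increment_nonneg _ _ _) (P.increment_nonneg _ _ _)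
    have h2 : (P.played ω T).mass v ≤ P.totalIncrement ω v T ∧
        (2 : ℝ) ^ (P.played ω T).phase v ≤ 2 ^ firstPhase K +
          2 * (P.totalIncrement ω v T + P.increment (P.after ω T) (T + 1) v) := by
      simp only [played, beginRound]
      split_ifs with h
      · exact ⟨ih.1, by linarith [ih.2]⟩
      · refine ⟨hn, ?_⟩
        -- The failed test gives `2 ^ r < mass + X'`; doubling it bounds `2 ^ (r + 1)`.
        rw [pow_succ]
        have : (0 : ℝ) < 2 ^ firstPhase K := by positivity
        linarith [ih.1]
    rw [hmass, hp, hT]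
    exact ⟨by linarith [h2.1], by linarith [h2.2]⟩

theorem sum_totalIncrement_le (ω : ℕ → Profile A K) (T : ℕ) :
    ∑ v, P.q v * P.totalIncrement ω v T ≤ 4 * (P.alpha + P.d * P.Q) * T := by
  simp only [totalIncrement, Finset.mul_sum]
  rw [Finset.sum_comm]
  refine (Finset.sum_le_sum fun t _ => ?_).trans
    (le_of_eq (by rw [Finset.sum_const, Finset.card_range, nsmul_eq_mul, mul_comm]))
  simp only [mul_add, Finset.sum_add_distrib]
  linarith [P.sum_increment_le (P.after ω t) (t + 1), P.sum_increment_le (P.played ω t) (t + 1)]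

/-! ### The expected regret of one agent -/

theorem excess_expect (T : ℕ) (k : K) :
    ∑ ω : Fin T → Profile A K, (P.law T ω).toReal * P.excess T ω k =
      ∑ v, P.q v * P.expect T fun ω =>
        ∑ t ∈ Finset.range T, ∑ i, P.dist ω t i v * (P.loss (t + 1) i - P.loss (t + 1) k) := by
  rw [expect_law]
  have e1 : (fun ω : ℕ → Profile A K => P.excess T (fun i => ω i) k) = fun ω =>
      ∑ v, ∑ t ∈ Finset.range T,
        (fun o : Option K => o.elim 0 fun j => P.loss (t + 1) j - P.loss (t + 1) k) (ω t v) := by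
    funext ω
    unfold excess
    rw [Fin.sum_univ_eq_sum_range (fun t => ∑ v, (ω t v).elim 0 (P.loss (t + 1))) T,
      Fin.sum_univ_eq_sum_range (fun t => ((Finset.univ.filter fun v =>
        (ω t v).isSome).card : ℝ) * P.loss (t + 1) k) T, ← Finset.sum_sub_distrib,
      Finset.sum_comm]
    refine Finset.sum_congr rfl fun t _ => ?_
    rw [Finset.card_filter, Nat.cast_sum, Finset.sum_mul, ← Finset.sum_sub_distrib]
    refine Finset.sum_congr rfl fun v _ => ?_
    cases ω t v <;> simp
  rw [e1, expect_sum]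
  refine Finset.sum_congr rfl fun v _ => ?_
  rw [expect_sum, expect_sum, Finset.mul_sum]
  refine Finset.sum_congr rfl fun t ht => ?_
  have ht' : t < T := Finset.mem_range.1 ht
  rw [P.expect_of_dependsOn (t := t + 1) (T := T) _ ht', P.expect_succ_outcome t v
      (fun o => o.elim 0 fun j => P.loss (t + 1) j - P.loss (t + 1) k),
    ← expect_const_mul, P.expect_of_dependsOn (t := t) (T := T) _ ht'.le]
  · congr 1
    funext ω
    rw [Fintype.sum_option, Finset.mul_sum]
    simp only [Option.elim, mul_zero, zero_add, agentProb, dist, mul_assoc]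
  · intro ω ω' h
    simp only [dist, P.played_congr h]
  · intro ω ω' h
    have : ω t = ω' t := h t (by simp)
    simp only [this]

theorem expect_regret_eq (T : ℕ) (v : A) (k : K) :
    (P.expect T fun ω =>
        ∑ t ∈ Finset.range T, ∑ i, P.dist ω t i v * (P.loss (t + 1) i - P.loss (t + 1) k)) =
      P.expect T fun ω => ∑ t ∈ Finset.range T,
        (∑ i, P.dist ω t i v * P.lossEst ω (t + 1) i v - P.lossEst ω (t + 1) k v) := by
  rw [expect_sum, expect_sum]
  refine Finset.sum_congr rfl fun t ht => ?_
  have ht' : t < T := Finset.mem_range.1 ht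
  have hdist' : ∀ {ω ω' : ℕ → Profile A K}, (∀ i ∈ Set.Iio t, ω i = ω' i) →
      P.dist ω t = P.dist ω' t := fun h => by
    unfold dist
    rw [P.played_congr h]
  have hdist : ∀ i, DependsOn (fun ω => P.dist ω t i v) (Set.Iio t) := fun i ω ω' h => by
    simp only [hdist' h]
  have hest : ∀ i, P.expect (t + 1) (fun ω => P.lossEst ω (t + 1) i v) = P.loss (t + 1) i := by
    intro i
    have := P.expect_succ_mul_lossEst (h := fun _ => 1) (s := t) (fun _ _ _ => rfl) i v
    simpa only [one_mul, expect_const] using this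
  rw [P.expect_of_dependsOn (t := t) (T := T) _ ht'.le,
    P.expect_of_dependsOn (t := t + 1) (T := T) _ ht', expect_sub, hest]
  · have hmul : ∀ i, P.expect (t + 1) (fun ω => P.dist ω t i v * P.lossEst ω (t + 1) i v) =
        P.expect t (fun ω => P.dist ω t i v * P.loss (t + 1) i) := fun i =>
      P.expect_succ_mul_lossEst (hdist i) i v
    rw [expect_sum (T := t + 1), Finset.sum_congr rfl fun i _ => hmul i]
    rw [← expect_sum, ← P.expect_const t (P.loss (t + 1) k), ← expect_sub, expect_const]
    congr 1
    funext ω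
    simp only [mul_sub, Finset.sum_sub_distrib, ← Finset.sum_mul, sum_dist, one_mul]
  · intro ω ω' h
    have h1 := hdist' fun i hi => h i (Set.Iio_subset_Iio t.le_succ hi)
    have h2 : P.lossEst ω (t + 1) = P.lossEst ω' (t + 1) := by
      funext i u
      exact P.dependsOn_lossEst (t + 1) i u h
    simp only [h1, h2]
  · intro ω ω' h
    simp only [hdist' h]

theorem log_div_rate (hK : 1 < Fintype.card K) (r : ℕ) :
    Real.log (Fintype.card K) / rate K r =
      Real.sqrt (Real.log (Fintype.card K)) * Real.sqrt (2 ^ r) := by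
  have hL : 0 < Real.log (Fintype.card K) := Real.log_pos (by exact_mod_cast hK)
  have h2 : (0 : ℝ) < 2 ^ r := by positivity
  rw [rate, Real.sqrt_div hL.le, div_div_eq_mul_div, mul_div_right_comm, Real.div_sqrt]

theorem rate_mul_two_pow (r : ℕ) :
    rate K r * 2 ^ r = Real.sqrt (Real.log (Fintype.card K)) * Real.sqrt (2 ^ r) := by
  have h2 : (0 : ℝ) < 2 ^ r := by positivity
  rw [rate, Real.sqrt_div' _ h2.le, div_mul_eq_mul_div, mul_div_assoc, Real.div_sqrt]

/-- The learning rate balances `ln |K| / η_r` against `η_r 2 ^ r`, whence the factor 2. The pathwise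
bounds are combined only after `drift` has been exchanged for `driftBound` in expectation. -/
theorem expect_agent_regret_le (hK : 1 < Fintype.card K) (T : ℕ) (v : A) (k : K) :
    (P.expect T fun ω =>
        ∑ t ∈ Finset.range T, ∑ i, P.dist ω t i v * (P.loss (t + 1) i - P.loss (t + 1) k)) ≤
      P.expect T fun ω => ∑ r ∈ Finset.range ((P.after ω T).phase v + 1),
        (2 * Real.sqrt (Real.log (Fintype.card K)) * Real.sqrt (2 ^ r) + (P.d + 2)) := by
  rw [expect_regret_eq]
  have h1 : (P.expect T fun ω => ∑ t ∈ Finset.range T, P.drift ω t v) ≤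
      P.expect T fun ω => ∑ t ∈ Finset.range T, P.driftBound ω t v := by
    rw [expect_sum, expect_sum]
    refine Finset.sum_le_sum fun t ht => ?_
    have ht' : t < T := Finset.mem_range.1 ht
    rw [P.expect_of_dependsOn (t := t + 1) (T := T) _ ht',
      P.expect_of_dependsOn (t := t) (T := T) _ ht'.le]
    · exact P.expect_drift_le t v
    · intro ω ω' h
      have h1 : P.dist ω t = P.dist ω' t := by
        unfold dist
        rw [P.played_congr h]
      have hsub : ∀ i < t - P.d, ω i = ω' i := fun i hi => h i (Set.mem_Iio.2 (by omega))
      have h3 : P.regularRate ω t v = P.regularRate ω' t v := P.dependsOn_regularRate t v hsub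
      have h4 : P.irregular ω t v = P.irregular ω' t v := P.dependsOn_irregular t v hsub
      simp only [driftBound, h1, h3, h4]
    · intro ω ω' h
      have h1 : P.dist ω t = P.dist ω' t := by
        unfold dist
        rw [P.played_congr fun i hi => h i (Set.mem_Iio.2 (by omega))]
      have h2 : ∀ s ≤ t + 1, P.lossEst ω s = P.lossEst ω' s := by
        intro s hs
        funext i u
        exact P.dependsOn_lossEst s i u fun j hj => h j (by simp only [Set.mem_Iio] at *; omega)
      have hsub : ∀ i < t - P.d, ω i = ω' i := fun i hi => h i (Set.mem_Iio.2 (by omega))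
      have h3 : P.regularRate ω t v = P.regularRate ω' t v := P.dependsOn_regularRate t v hsub
      have h4 : P.irregular ω t v = P.irregular ω' t v := P.dependsOn_irregular t v hsub
      have h5 : ∀ i, ∑ s ∈ Finset.Ico (t + 1 - P.d) (t + 1), P.lossEst ω s i v =
          ∑ s ∈ Finset.Ico (t + 1 - P.d) (t + 1), P.lossEst ω' s i v := fun i =>
        Finset.sum_congr rfl fun s hs => by rw [h2 s (Finset.mem_Ico.1 hs).2.le]
      simp only [drift, h1, h2 _ le_rfl, h3, h4, h5]
  have h2 : P.expect T (fun ω => ∑ t ∈ Finset.range T,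
      (∑ i, P.dist ω t i v * P.lossEst ω (t + 1) i v - P.lossEst ω (t + 1) k v)) -
      (P.expect T fun ω => ∑ t ∈ Finset.range T, P.drift ω t v) +
      (P.expect T fun ω => ∑ t ∈ Finset.range T, P.driftBound ω t v) ≤
      P.expect T fun ω => ∑ r ∈ Finset.range ((P.after ω T).phase v + 1),
        (2 * Real.sqrt (Real.log (Fintype.card K)) * Real.sqrt (2 ^ r) + (P.d + 2)) := by
    rw [← expect_sub, ← expect_add]
    refine P.expect_mono fun ω => ?_
    have a1 := P.sum_regret_sub_drift_le hK ω v k T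
    have a2 := P.potential_le hK ω v k ((P.after ω T).phase v) ((P.after ω T).start v) (T + 1)
    have a3 := P.sum_driftBound_le ω v T
    have a4 := P.phaseCost_le (P.after ω T) T v
    have a5 : ∑ r ∈ Finset.range ((P.after ω T).phase v + 1),
        (2 * Real.sqrt (Real.log (Fintype.card K)) * Real.sqrt (2 ^ r) + (P.d + 2 : ℝ)) =
        ∑ r ∈ Finset.range ((P.after ω T).phase v + 1), Real.log (Fintype.card K) / rate K r +
        ∑ r ∈ Finset.range ((P.after ω T).phase v + 1), (rate K r * 2 ^ r + (P.d + 2 : ℝ)) := by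
      rw [← Finset.sum_add_distrib]
      refine Finset.sum_congr rfl fun r _ => ?_
      rw [log_div_rate hK, rate_mul_two_pow]
      ring
    rw [a5, Finset.sum_range_succ, Finset.sum_range_succ]
    rw [Finset.sum_sub_distrib] at a1
    linarith
  linarith

end Problem
end CoopLearning

/-! ### Summing over phases and agents -/

namespace CoopLearning

theorem sum_sqrt_two_pow_le (R : ℕ) :
    ∑ r ∈ Finset.range (R + 1), Real.sqrt (2 ^ r) ≤ 4 * Real.sqrt (2 ^ R) := by
  induction R with
  | zero => norm_num
  | succ R ih =>
    rw [Finset.sum_range_succ]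
    have h : Real.sqrt (2 ^ (R + 1)) = Real.sqrt (2 ^ R) * Real.sqrt 2 := by
      rw [pow_succ, Real.sqrt_mul (by positivity)]
    -- The induction with constant 4 needs `4 + √2 ≤ 4 √2`, that is `√2 ≥ 4 / 3`.
    have h2 : (4 / 3 : ℝ) ≤ Real.sqrt 2 := Real.le_sqrt_of_sq_le (by norm_num)
    rw [h] at *
    nlinarith [Real.sqrt_nonneg ((2 : ℝ) ^ R)]

theorem card_two_pow_lt_le (R m : ℕ) :
    ((Finset.range R).filter fun r => 2 ^ r < (m + 2) ^ 2).card ≤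
      Nat.log 2 ((m + 2) ^ 2) + 1 := by
  refine (Finset.card_le_card fun r hr => ?_).trans_eq (Finset.card_range _)
  have h := (Finset.mem_filter.1 hr).2
  exact Finset.mem_range.2 (Nat.lt_succ_of_le (Nat.le_log_of_pow_le one_lt_two h.le))

/-- Once `2 ^ r ≥ (m + 2) ^ 2` the summand hides in the geometric sum; only the earlier phases are
counted. -/
theorem sum_const_le_sqrt_two_pow (R m : ℕ) :
    ∑ _r ∈ Finset.range (R + 1), (m + 2 : ℝ) ≤
      4 * Real.sqrt (2 ^ R) + (m + 2) * (2 * Real.logb 2 (m + 2) + 1) := by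
  have h1 : ∀ r : ℕ, (m + 2 : ℝ) ≤ Real.sqrt (2 ^ r) +
      (m + 2) * if 2 ^ r < (m + 2) ^ 2 then 1 else 0 := by
    intro r
    split_ifs with h
    · linarith [Real.sqrt_nonneg ((2 : ℝ) ^ r)]
    · rw [mul_zero, add_zero]
      refine Real.le_sqrt_of_sq_le ?_
      exact_mod_cast not_lt.1 h
  have h2 : ((Nat.log 2 ((m + 2) ^ 2) : ℕ) : ℝ) ≤ 2 * Real.logb 2 (m + 2) := by
    refine (Real.natLog_le_logb _ _).trans_eq ?_
    push_cast
    rw [Real.logb_pow]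
    norm_num
  have h3 : (((Finset.range (R + 1)).filter fun r => 2 ^ r < (m + 2) ^ 2).card : ℝ) ≤
      2 * Real.logb 2 (m + 2) + 1 := by
    have : (((Finset.range (R + 1)).filter fun r => 2 ^ r < (m + 2) ^ 2).card : ℝ) ≤
      ((Nat.log 2 ((m + 2) ^ 2) + 1 : ℕ) : ℝ) := by exact_mod_cast card_two_pow_lt_le _ _
    push_cast at this
    linarith
  refine (Finset.sum_le_sum fun r _ => h1 r).trans ?_
  rw [Finset.sum_add_distrib, ← Finset.mul_sum, Finset.sum_boole]
  exact add_le_add (sum_sqrt_two_pow_le R) (mul_le_mul_of_nonneg_left h3 (by positivity))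

theorem two_mul_logb_add_one_le {d T : ℕ} (h : d < T) :
    2 * Real.logb 2 (d + 2) + 1 ≤ 4 * (1 + Real.log T) := by
  have hT : (1 : ℝ) ≤ T := by exact_mod_cast (by omega : 1 ≤ T)
  have hd : (d : ℝ) + 1 ≤ T := by exact_mod_cast h
  have h1 : Real.logb 2 (d + 2) ≤ Real.logb 2 (2 * T) :=
    Real.logb_le_logb_of_le one_lt_two (by positivity) (by linarith)
  rw [Real.logb_mul (by norm_num) (by positivity), Real.logb_self_eq_one one_lt_two] at h1
  have h2 : Real.logb 2 T ≤ 2 * Real.log T := by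
    rw [Real.logb, div_le_iff₀ (Real.log_pos one_lt_two)]
    nlinarith [Real.log_two_gt_d9, Real.log_nonneg hT]
  linarith

/-- Rounding up costs at most a factor 2; the 1 covers an index cut off at `0`. -/
theorem two_pow_firstPhase_le (K : Type*) [Fintype K] (hK : 1 < Fintype.card K) :
    (2 : ℝ) ^ firstPhase K ≤ 1 + 2 * Real.log (Fintype.card K) := by
  have hL : 0 < Real.log (Fintype.card K) := Real.log_pos (by exact_mod_cast hK)
  rcases Nat.eq_zero_or_pos (firstPhase K) with h | h
  · rw [h, pow_zero]; linarith
  · have h0 : 0 < Real.logb 2 (Real.log (Fintype.card K)) := Nat.ceil_pos.1 h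
    have h1 := Nat.ceil_lt_add_one h0.le
    have h2 : ((firstPhase K : ℕ) : ℝ) ≤ Real.logb 2 (Real.log (Fintype.card K)) + 1 := h1.le
    rw [← Real.rpow_natCast]
    refine (Real.rpow_le_rpow_of_exponent_le one_le_two h2).trans ?_
    rw [Real.rpow_add two_pos, Real.rpow_logb two_pos (by norm_num) hL, Real.rpow_one]
    linarith

namespace Problem

open Classical

set_option linter.unusedSectionVars false

variable {A K : Type*} [Fintype A] [Fintype K] [Nonempty K] (P : Problem A K)

theorem agent_cost_le (R : ℕ) :
    ∑ r ∈ Finset.range (R + 1),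
        (2 * Real.sqrt (Real.log (Fintype.card K)) * Real.sqrt (2 ^ r) + (P.d + 2 : ℝ)) ≤
      4 * (2 * Real.sqrt (Real.log (Fintype.card K)) + 1) * Real.sqrt (2 ^ R) +
        (P.d + 2) * (2 * Real.logb 2 (P.d + 2) + 1) := by
  rw [Finset.sum_add_distrib, ← Finset.mul_sum]
  have h1 := mul_le_mul_of_nonneg_left (sum_sqrt_two_pow_le R)
    (by positivity : 0 ≤ 2 * Real.sqrt (Real.log (Fintype.card K)))
  have h2 := sum_const_le_sqrt_two_pow R P.d
  linarith

/-- Cauchy–Schwarz over the agents. The constant is `1 + 2 ln |K|` from the first phase plus `8 = 2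
· 4` from the increments. -/
theorem sum_mul_sqrt_phase_le (hK : 1 < Fintype.card K) {T : ℕ} (hT : 1 ≤ T)
    (ω : ℕ → Profile A K) :
    ∑ v, P.q v * Real.sqrt (2 ^ (P.after ω T).phase v) ≤
      Real.sqrt (9 + 2 * Real.log (Fintype.card K)) *
        Real.sqrt (P.Q * (P.alpha + P.d * P.Q) * T) := by
  have hT' : (1 : ℝ) ≤ T := by exact_mod_cast hT
  have hL : 0 < Real.log (Fintype.card K) := Real.log_pos (by exact_mod_cast hK)
  have hQ := P.Q_nonneg
  have hZ := P.Q_le_alpha_add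
  have h1 : ∑ v, P.q v * 2 ^ (P.after ω T).phase v ≤
      (9 + 2 * Real.log (Fintype.card K)) * ((P.alpha + P.d * P.Q) * T) := by
    calc ∑ v, P.q v * 2 ^ (P.after ω T).phase v
        ≤ ∑ v, P.q v * ((1 + 2 * Real.log (Fintype.card K)) + 2 * P.totalIncrement ω v T) := by
          refine Finset.sum_le_sum fun v _ => mul_le_mul_of_nonneg_left ?_ (P.q_pos v).le
          linarith [(P.two_pow_phase_le ω v T).2, two_pow_firstPhase_le K hK]
      _ = P.Q * (1 + 2 * Real.log (Fintype.card K)) +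
          2 * ∑ v, P.q v * P.totalIncrement ω v T := by
          simp only [mul_add, Finset.sum_add_distrib, Q, Finset.sum_mul, Finset.mul_sum]
          congr 1
          exact Finset.sum_congr rfl fun v _ => by ring
      _ ≤ ((P.alpha + P.d * P.Q) * T) * (1 + 2 * Real.log (Fintype.card K)) +
          2 * (4 * (P.alpha + P.d * P.Q) * T) := by
          refine add_le_add (mul_le_mul_of_nonneg_right ?_ (by linarith))
            (mul_le_mul_of_nonneg_left (P.sum_totalIncrement_le ω T) zero_le_two)
          nlinarith
      _ = _ := by ring
  have h2 : (∑ v, P.q v * Real.sqrt (2 ^ (P.after ω T).phase v)) ^ 2 ≤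
      P.Q * ∑ v, P.q v * 2 ^ (P.after ω T).phase v := by
    refine Finset.sum_sq_le_sum_mul_sum_of_sq_le_mul _ (fun v _ => (P.q_pos v).le)
      (fun v _ => mul_nonneg (P.q_pos v).le (by positivity)) fun v _ => ?_
    rw [mul_pow, Real.sq_sqrt (by positivity)]
    exact le_of_eq (by ring)
  rw [← Real.sqrt_mul (by linarith)]
  refine Real.le_sqrt_of_sq_le (h2.trans ?_)
  have := mul_le_mul_of_nonneg_left h1 hQ
  linarith

theorem sum_dist_regret_le (T : ℕ) (k : K) (ω : ℕ → Profile A K) (v : A) :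
    ∑ t ∈ Finset.range T, ∑ i, P.dist ω t i v * (P.loss (t + 1) i - P.loss (t + 1) k) ≤ T := by
  have : ∀ t ∈ Finset.range T,
      ∑ i, P.dist ω t i v * (P.loss (t + 1) i - P.loss (t + 1) k) ≤ 1 := by
    intro t _
    rw [← P.sum_dist ω t v]
    refine Finset.sum_le_sum fun i _ => mul_le_of_le_one_right (P.dist_pos ω t i v).le ?_
    linarith [P.loss_le_one (t + 1) i, P.loss_nonneg (t + 1) k]
  simpa using Finset.sum_le_sum this

theorem expect_excess_le (T : ℕ) (k : K) :
    ∑ ω : Fin T → Profile A K, (P.law T ω).toReal * P.excess T ω k ≤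
      48 * (1 + Real.log ((Fintype.card K : ℝ) * T)) *
        Real.sqrt (P.Q * (P.alpha + P.d * P.Q) * T) := by
  rw [excess_expect]
  have hQ := P.Q_nonneg
  have hZ := P.Q_le_alpha_add
  have hcard : (1 : ℝ) ≤ Fintype.card K := by exact_mod_cast Fintype.card_pos
  set s := Real.sqrt (P.Q * (P.alpha + P.d * P.Q) * T) with hs
  have hs0 : 0 ≤ s := Real.sqrt_nonneg _
  have hL0 : 0 ≤ Real.log (Fintype.card K) := Real.log_nonneg hcard
  have hLT : 0 ≤ Real.log T := Real.log_natCast_nonneg T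
  rcases Nat.eq_zero_or_pos T with rfl | hT
  · simp only [expect, Finset.range_zero, Finset.sum_empty, mul_zero, Finset.sum_const_zero]
    have : 0 ≤ Real.log ((Fintype.card K : ℝ) * (0 : ℕ)) := by simp
    positivity
  have hT' : (1 : ℝ) ≤ T := by exact_mod_cast hT
  rw [Real.log_mul (by positivity) (by positivity)]
  rcases Nat.lt_or_ge 1 (Fintype.card K) with hK | hK
  swap
  -- With one action the learning rate is 0 and the potential is useless, but the regret vanishes.
  · have : Subsingleton K := Fintype.card_le_one_iff_subsingleton.1 hK
    have h0 : ∀ t i, P.loss t i - P.loss t k = 0 := fun t i => by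
      rw [Subsingleton.elim i k, sub_self]
    simp only [h0, mul_zero, Finset.sum_const_zero, expect_const]
    positivity
  rcases Nat.lt_or_ge P.d T with hd | hd
  swap
  -- If `T ≤ d`, then `(Q T) ^ 2 ≤ Q (d Q) T`, so the trivial regret `Q T` is within the bound.
  · have hd' : (T : ℝ) ≤ P.d := by exact_mod_cast hd
    have h1 : P.Q * T ≤ s := by
      refine Real.le_sqrt_of_sq_le ?_
      have ha : (0 : ℝ) ≤ P.alpha := Nat.cast_nonneg _
      have h2 : P.Q * T ≤ P.alpha + P.d * P.Q := by nlinarith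
      have := mul_le_mul_of_nonneg_left h2 (by positivity : 0 ≤ P.Q * T)
      linarith
    have h2 : ∑ v, P.q v * P.expect T (fun ω =>
        ∑ t ∈ Finset.range T, ∑ i, P.dist ω t i v * (P.loss (t + 1) i - P.loss (t + 1) k)) ≤
        P.Q * T := by
      rw [Q, Finset.sum_mul]
      refine Finset.sum_le_sum fun v _ => mul_le_mul_of_nonneg_left ?_ (P.q_pos v).le
      exact (P.expect_mono fun ω => P.sum_dist_regret_le T k ω v).trans_eq
        (P.expect_const T T)
    nlinarith [mul_nonneg hL0 hs0, mul_nonneg hLT hs0]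
  · set L := Real.log (Fintype.card K) with hL
    have h1 : ∑ v, P.q v * P.expect T (fun ω =>
        ∑ t ∈ Finset.range T, ∑ i, P.dist ω t i v * (P.loss (t + 1) i - P.loss (t + 1) k)) ≤
        ∑ v, P.q v * P.expect T (fun ω =>
          4 * (2 * Real.sqrt L + 1) * Real.sqrt (2 ^ (P.after ω T).phase v) +
            (P.d + 2) * (2 * Real.logb 2 (P.d + 2) + 1)) := by
      refine Finset.sum_le_sum fun v _ => mul_le_mul_of_nonneg_left ?_ (P.q_pos v).le
      exact (P.expect_agent_regret_le hK T v k).trans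
        (P.expect_mono fun ω => P.agent_cost_le _)
    refine h1.trans ?_
    have h2 : ∑ v, P.q v * P.expect T (fun ω =>
          4 * (2 * Real.sqrt L + 1) * Real.sqrt (2 ^ (P.after ω T).phase v) +
            (P.d + 2) * (2 * Real.logb 2 (P.d + 2) + 1)) =
        4 * (2 * Real.sqrt L + 1) * P.expect T (fun ω =>
          ∑ v, P.q v * Real.sqrt (2 ^ (P.after ω T).phase v)) +
        P.Q * ((P.d + 2) * (2 * Real.logb 2 (P.d + 2) + 1)) := by
      simp only [expect_add, expect_const, expect_const_mul, expect_sum, mul_add,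
        Finset.sum_add_distrib, Q, Finset.sum_mul, Finset.mul_sum]
      congr 2
      funext v
      ring
    have h3 : P.expect T (fun ω => ∑ v, P.q v * Real.sqrt (2 ^ (P.after ω T).phase v)) ≤
        Real.sqrt (9 + 2 * L) * s :=
      (P.expect_mono fun ω => P.sum_mul_sqrt_phase_le hK hT ω).trans_eq (P.expect_const T _)
    have h4 : (2 * Real.sqrt L + 1) * Real.sqrt (9 + 2 * L) ≤ 9 * (1 + L) := by
      have hx := Real.sq_sqrt hL0
      have hy := Real.sq_sqrt (by linarith : (0 : ℝ) ≤ 9 + 2 * L)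
      refine abs_le_of_sq_le_sq' ?_ (by positivity) |>.2
      have hz : (2 * Real.sqrt L + 1) ^ 2 ≤ 8 * L + 2 := by
        nlinarith [sq_nonneg (2 * Real.sqrt L - 1)]
      rw [mul_pow, hy]
      nlinarith [mul_le_mul_of_nonneg_right hz (by linarith : (0 : ℝ) ≤ 9 + 2 * L)]
    -- Both `Q d` and `Q` are at most `s`: the first since `d < T`, the second by `Q_le_alpha_add`.
    have h5 : P.Q * (P.d + 2) ≤ 3 * s := by
      have ha : (0 : ℝ) ≤ P.alpha := Nat.cast_nonneg _
      have hd' : (P.d : ℝ) ≤ T := by exact_mod_cast hd.le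
      have hd0 : (0 : ℝ) ≤ P.d := Nat.cast_nonneg _
      have a1 : P.Q * P.d ≤ s := by
        refine Real.le_sqrt_of_sq_le ?_
        have b1 : P.Q * (P.d * P.Q) * P.d ≤ P.Q * (P.d * P.Q) * T :=
          mul_le_mul_of_nonneg_left hd' (by positivity)
        have b2 : 0 ≤ P.Q * P.alpha * T := by positivity
        nlinarith
      have a2 : P.Q ≤ s := by
        refine Real.le_sqrt_of_sq_le ?_
        have b1 : P.Q * P.Q ≤ P.Q * (P.alpha + P.d * P.Q) := mul_le_mul_of_nonneg_left hZ hQ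
        have b2 : P.Q * (P.alpha + P.d * P.Q) * 1 ≤ P.Q * (P.alpha + P.d * P.Q) * T :=
          mul_le_mul_of_nonneg_left hT' (mul_nonneg hQ (hQ.trans hZ))
        nlinarith
      linarith
    have h6 := two_mul_logb_add_one_le hd
    rw [h2]
    have h7 : 4 * (2 * Real.sqrt L + 1) * P.expect T (fun ω =>
        ∑ v, P.q v * Real.sqrt (2 ^ (P.after ω T).phase v)) ≤ 36 * (1 + L) * s := by
      calc _ ≤ 4 * (2 * Real.sqrt L + 1) * (Real.sqrt (9 + 2 * L) * s) :=
            mul_le_mul_of_nonneg_left h3 (by positivity)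
        _ = 4 * ((2 * Real.sqrt L + 1) * Real.sqrt (9 + 2 * L)) * s := by ring
        _ ≤ 4 * (9 * (1 + L)) * s := by gcongr
        _ = _ := by ring
    have h8 : P.Q * ((P.d + 2) * (2 * Real.logb 2 (P.d + 2) + 1)) ≤
        12 * (1 + Real.log T) * s := by
      calc _ = P.Q * (P.d + 2) * (2 * Real.logb 2 (P.d + 2) + 1) := by ring
        _ ≤ P.Q * (P.d + 2) * (4 * (1 + Real.log T)) :=
            mul_le_mul_of_nonneg_left h6 (by positivity)
        _ ≤ 3 * s * (4 * (1 + Real.log T)) := mul_le_mul_of_nonneg_right h5 (by positivity)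
        _ = _ := by ring
    -- The final constant is `48 = 36 + 12`, from `h7` and `h8`.
    nlinarith [mul_nonneg hL0 hs0, mul_nonneg hLT hs0]

end Problem

end CoopLearning

theorem theorem2 :
    ∃ C : ℝ, 0 < C ∧ ∃ k : ℕ,
      ∀ (A : Type*) (K : Type*) [Fintype A] [Fintype K] [Nonempty K]
        (P : CoopLearning.Problem A K) (T : ℕ),
        P.regret T ≤
          C * (1 + Real.log ((Fintype.card K : ℝ) * T)) ^ k *
            Real.sqrt (P.Q * ((P.alpha : ℝ) + P.d * P.Q) * T) := by
  refine ⟨48, by norm_num, 1, fun A K _ _ _ P T => ?_⟩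
  rw [pow_one]
  exact Finset.sup'_le _ _ fun k _ => P.expect_excess_le T k
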